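/- Let $n$ be a positive integer, $\Gamma$ a finitely generated group, and let $G_{\mathbb C}$ be one of $\mathrm{GL}(n,\mathbb C)$, $\mathrm{SL}(n,\mathbb C)$, $\mathrm{O}(n,\mathbb C)=\{M : {}^tMM=I_n\}$, $\mathrm{SO}(n,\mathbb C)=\mathrm{SL}(n,\mathbb C)\cap \mathrm{O}(n,\mathbb C)$, $\mathrm{Sp}(2n,\mathbb C)=\{M : {}^tMJ_{2n}M=J_{2n}\}$, a group of matrices of size $N$ ($N=2n$ for $\mathrm{Sp}(2n,\mathbb C)$, $N=n$ otherwise). Here $J_{2m}=\begin{pmatrix}0&I_m\\-I_m&0\end{pmatrix}$, $I_{p,q}=\begin{pmatrix}I_p&0\\0&-I_q\end{pmatrix}$, $K_{p,q}=\begin{pmatrix}I_{p,q}&0\\0&I_{p,q}\end{pmatrix}$, $D_{p,q}=\begin{pmatrix}I_p&0\\0&iI_q\end{pmatrix}$. Let $\mathbb C[\mathrm{Hom}(\Gamma,G_{\mathbb C})]$ be the algebra of functions on $\mathrm{Hom}(\Gamma,G_{\mathbb C})$ generated by the functions $\rho\mapsto\rho(\gamma)_{ij}$, and let the character variety $\mathcal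 X_{G_{\mathbb C}}(\Gamma)$ be the set of $\mathbb C$-algebra homomorphisms $\mathbb C[\mathrm{Hom}(\Gamma,G_{\mathbb C})]^{G_{\mathbb C}}\to\mathbb C$, where $G_{\mathbb C}$ acts by conjugation. For $\rho\in\mathrm{Hom}(\Gamma,G_{\mathbb C})$ let $\chi_\rho$ be the evaluation at $\rho$. Let $\varphi$ be one of the involutions $A\mapsto\overline A$, $A\mapsto({}^t\overline A)^{-1}$ of $G_{\mathbb C}$, and let $\Phi$ be the anti-holomorphic involution of $\mathcal X_{G_{\mathbb C}}(\Gamma)$ that it induces, $\Phi(x)(f)=\overline{x\big(\rho\mapsto\overline{f(\varphi\circ\rho)}\big)}$; so $\Phi(\chi_\rho)=\chi_{\varphi\circ\rho}$. Let $\rho\in\mathrm{Hom}(\Gamma,G_{\mathbb C})$ be irreducible, i.e. the only subspaces of $\mathbb C^{N}$ stable by $\rho(\Gamma)$ are $0$ and $\mathbb C^N$, and suppose that $\Phi(\chi_\rho)=\chi_\rho$. Then there exist a real form $G_{\mathbb R}$ of $G_{\mathbb C}$ in the list below, $\sigma\in\mathrm{Hom}(\Gamma,G_{\mathbb R})$ and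 $P\in G_{\mathbb C}$ such that $P\rho(\gamma)P^{-1}=\sigma(\gamma)$ for all $\gamma\in\Gamma$. The real forms are the following, where $p\ge q\ge 0$ are integers. - For $\mathrm{GL}(n,\mathbb C)$: $\mathrm{GL}(n,\mathbb R)$; $\mathrm U(p,q)=\{M : {}^t\overline M I_{p,q}M=I_{p,q}\}$ with $p+q=n$; and, if $n=2m$, $\mathrm{GL}(m,\mathbb H)=\{M\in \mathrm{GL}(2m,\mathbb C) : MJ_{2m}=J_{2m}\overline M\}$. - For $\mathrm{SL}(n,\mathbb C)$: the intersections of these groups with $\mathrm{SL}(n,\mathbb C)$. - For $\mathrm{Sp}(2n,\mathbb C)$: the group $\mathrm{Sp}(2n,\mathbb R)$ of its real matrices; and $\mathrm{Sp}(2p,2q)=\{M\in\mathrm{Sp}(2n,\mathbb C) : {}^t\overline M K_{p,q}M=K_{p,q}\}$ with $p+q=n$. - For $\mathrm{O}(n,\mathbb C)$: $D_{p,q}\,\mathrm O(p,q)\,D_{p,q}^{-1}$ with $p+q=n$, where $\mathrm O(p,q)=\{M\in\mathrm{GL}(n,\mathbb R) : {}^tMI_{p,q}M=I_{p,q}\}$;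 and, if $n=2m$, $\mathrm O(m,\mathbb H)=\{M\in\mathrm O(2m,\mathbb C) : J_{2m}M=\overline MJ_{2m}\}$. - For $\mathrm{SO}(n,\mathbb C)$: $D_{p,q}\,\mathrm{SO}(p,q)\,D_{p,q}^{-1}$ with $p+q=n$, where $\mathrm{SO}(p,q)$ is the group of the matrices of determinant $1$ in $\mathrm O(p,q)$; if $n=2m$, $\mathrm{SO}(m,\mathbb H)=\mathrm O(m,\mathbb H)\cap\mathrm{SL}(2m,\mathbb C)$; and, if moreover $m$ is even, $\mathrm{SO}^-(m,\mathbb H)=P_0\,\mathrm{SO}(m,\mathbb H)\,P_0^{-1}$, where $P_0$ is any matrix in $\mathrm O(n,\mathbb C)\setminus\mathrm{SO}(n,\mathbb C)$, fixed beforehand. -/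

import Mathlib

open Matrix

namespace CharVar

noncomputable section

/-! ### Block matrices -/

/-- The identification of `{1,…,p} ⊔ {1,…,q}` with `{1,…,n}`, first block first, when `p + q = n`. -/
def blockEquiv {p q n : ℕ} (h : p + q = n) : Fin p ⊕ Fin q ≃ Fin n :=
  finSumFinEquiv.trans (finCongr h)

/-- `J_{2m} = [[0, I_m], [-I_m, 0]]`, of size `n = 2m`. -/
def matJ {m n : ℕ} (h : m + m = n) : Matrix (Fin n) (Fin n) ℂ :=
  reindex (blockEquiv h) (blockEquiv h) (fromBlocks 0 1 (-1) 0)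

/-- `I_{p,q} = [[I_p, 0], [0, -I_q]]`, of size `n = p + q`. -/
def matI {p q n : ℕ} (h : p + q = n) : Matrix (Fin n) (Fin n) ℂ :=
  reindex (blockEquiv h) (blockEquiv h) (fromBlocks 1 0 0 (-1))

/-- `K_{p,q} = [[I_{p,q}, 0], [0, I_{p,q}]]`, of size `n = 2m` where `p + q = m`. -/
def matK {p q m n : ℕ} (h : p + q = m) (h' : m + m = n) : Matrix (Fin n) (Fin n) ℂ :=
  reindex (blockEquiv h') (blockEquiv h') (fromBlocks (matI h) 0 0 (matI h))

/-- `D_{p,q} = [[I_p, 0], [0, i I_q]]`, of size `n = p + q`, as an invertible matrix. -/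
def matD {p q n : ℕ} (h : p + q = n) : GL (Fin n) ℂ where
  val := reindex (blockEquiv h) (blockEquiv h) (fromBlocks 1 0 0 (Complex.I • 1))
  inv := reindex (blockEquiv h) (blockEquiv h) (fromBlocks 1 0 0 ((-Complex.I) • 1))
  val_inv := by simp [submatrix_mul_equiv, fromBlocks_multiply, smul_smul]
  inv_val := by simp [submatrix_mul_equiv, fromBlocks_multiply, smul_smul]

/-! ### Subgroups of `GL(n, ℂ)` -/

/-- The invertible matrices `M` with `ᵗM B M = B`. -/
def bilinGroup {n : ℕ} (B : Matrix (Fin n) (Fin n) ℂ) : Subgroup (GL (Fin n) ℂ) where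
  carrier := {M | M.valᵀ * B * M.val = B}
  one_mem' := by simp
  mul_mem' := by
    intro M N hM hN
    simp only [Set.mem_ofPred_eq, Units.val_mul, transpose_mul] at *
    calc N.valᵀ * M.valᵀ * B * (M.val * N.val) = N.valᵀ * (M.valᵀ * B * M.val) * N.val := by
          simp only [Matrix.mul_assoc]
      _ = B := by rw [hM, hN]
  inv_mem' := by
    intro M hM
    simp only [Set.mem_ofPred_eq] at *
    have h1 : M.val * (M⁻¹).val = 1 := M.mul_inv
    have h2 : (M⁻¹).valᵀ * M.valᵀ = 1 := by rw [← transpose_mul, h1, transpose_one]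
    calc (M⁻¹).valᵀ * B * (M⁻¹).val
        = (M⁻¹).valᵀ * (M.valᵀ * B * M.val) * (M⁻¹).val := by rw [hM]
      _ = ((M⁻¹).valᵀ * M.valᵀ) * B * (M.val * (M⁻¹).val) := by simp only [Matrix.mul_assoc]
      _ = B := by rw [h1, h2, Matrix.one_mul, Matrix.mul_one]

/-- The invertible matrices `M` with `M* H M = H`. -/
def hermGroup {n : ℕ} (H : Matrix (Fin n) (Fin n) ℂ) : Subgroup (GL (Fin n) ℂ) where
  carrier := {M | M.valᴴ * H * M.val = H}
  one_mem' := by simp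
  mul_mem' := by
    intro M N hM hN
    simp only [Set.mem_ofPred_eq, Units.val_mul, conjTranspose_mul] at *
    calc N.valᴴ * M.valᴴ * H * (M.val * N.val) = N.valᴴ * (M.valᴴ * H * M.val) * N.val := by
          simp only [Matrix.mul_assoc]
      _ = H := by rw [hM, hN]
  inv_mem' := by
    intro M hM
    simp only [Set.mem_ofPred_eq] at *
    have h1 : M.val * (M⁻¹).val = 1 := M.mul_inv
    have h2 : (M⁻¹).valᴴ * M.valᴴ = 1 := by rw [← conjTranspose_mul, h1, conjTranspose_one]
    calc (M⁻¹).valᴴ * H * (M⁻¹).val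
        = (M⁻¹).valᴴ * (M.valᴴ * H * M.val) * (M⁻¹).val := by rw [hM]
      _ = ((M⁻¹).valᴴ * M.valᴴ) * H * (M.val * (M⁻¹).val) := by simp only [Matrix.mul_assoc]
      _ = H := by rw [h1, h2, Matrix.one_mul, Matrix.mul_one]

/-- The involution `A ↦ Ā` of `GL(n, ℂ)`. -/
def conjHom (n : ℕ) : GL (Fin n) ℂ →* GL (Fin n) ℂ :=
  GeneralLinearGroup.map (starRingEnd ℂ)

/-- The involution `A ↦ (ᵗĀ)⁻¹` of `GL(n, ℂ)`. -/
def conjTransposeInvHom (n : ℕ) : GL (Fin n) ℂ →* GL (Fin n) ℂ where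
  toFun A := (star A)⁻¹
  map_one' := by simp
  map_mul' A B := by simp

/-- `SL(n, ℂ)` as a subgroup of `GL(n, ℂ)`. -/
def SLC (n : ℕ) : Subgroup (GL (Fin n) ℂ) := (GeneralLinearGroup.det).ker

/-- `O(n, ℂ)`, for the bilinear form with matrix `I_n`. -/
def OC (n : ℕ) : Subgroup (GL (Fin n) ℂ) := bilinGroup 1

/-- `SO(n, ℂ) = SL(n, ℂ) ∩ O(n, ℂ)`. -/
def SOC (n : ℕ) : Subgroup (GL (Fin n) ℂ) := SLC n ⊓ OC n

/-- `Sp(2m, ℂ)`, for the bilinear form with matrix `J_{2m}`; here `n = 2m`. -/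
def SpC {m n : ℕ} (h : m + m = n) : Subgroup (GL (Fin n) ℂ) := bilinGroup (matJ h)

/-- `GL(n, ℝ)`, embedded in `GL(n, ℂ)`. -/
def GLR (n : ℕ) : Subgroup (GL (Fin n) ℂ) :=
  (GeneralLinearGroup.map (n := Fin n) (algebraMap ℝ ℂ)).range

/-- `U(p, q)`. -/
def U {p q n : ℕ} (h : p + q = n) : Subgroup (GL (Fin n) ℂ) := hermGroup (matI h)

/-- `GL(m, ℍ)`: the matrices `M` in `GL(2m, ℂ)` with `M J = J M̄`; here `n = 2m`. -/
def GLH {m n : ℕ} (h : m + m = n) : Subgroup (GL (Fin n) ℂ) where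
  carrier := {M | M.val * matJ h = matJ h * (conjHom n M).val}
  one_mem' := by simp
  mul_mem' := by
    intro M N hM hN
    simp only [Set.mem_ofPred_eq, Units.val_mul, map_mul] at *
    rw [Matrix.mul_assoc, hN, ← Matrix.mul_assoc, hM, Matrix.mul_assoc]
  inv_mem' := by
    intro M hM
    simp only [Set.mem_ofPred_eq, map_inv] at *
    have h1 : (M⁻¹).val * M.val = 1 := M.inv_mul
    have h2 : (conjHom n M).val * ((conjHom n M)⁻¹).val = 1 := (conjHom n M).mul_inv
    calc (M⁻¹).val * matJ h
        = (M⁻¹).val * (matJ h * (conjHom n M).val) * ((conjHom n M)⁻¹).val := by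
          rw [Matrix.mul_assoc, Matrix.mul_assoc, h2, Matrix.mul_one]
      _ = ((M⁻¹).val * M.val) * matJ h * ((conjHom n M)⁻¹).val := by
          rw [← hM]; simp only [Matrix.mul_assoc]
      _ = matJ h * ((conjHom n M)⁻¹).val := by rw [h1, Matrix.one_mul]

/-- `Sp(2m, ℝ)`; here `n = 2m`. -/
def SpR {m n : ℕ} (h : m + m = n) : Subgroup (GL (Fin n) ℂ) := SpC h ⊓ GLR n

/-- `Sp(2p, 2q)`; here `m = p + q` and `n = 2m`. -/
def Sppq {p q m n : ℕ} (h : p + q = m) (h' : m + m = n) : Subgroup (GL (Fin n) ℂ) :=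
  SpC h' ⊓ hermGroup (matK h h')

/-- `O(p, q)`: the real invertible matrices `M` with `ᵗM I_{p,q} M = I_{p,q}`. -/
def Opq {p q n : ℕ} (h : p + q = n) : Subgroup (GL (Fin n) ℂ) := GLR n ⊓ bilinGroup (matI h)

/-- `SO(p, q)`. -/
def SOpq {p q n : ℕ} (h : p + q = n) : Subgroup (GL (Fin n) ℂ) := Opq h ⊓ SLC n

/-- The group `P H P⁻¹`. -/
def conjSubgroup {n : ℕ} (P : GL (Fin n) ℂ) (H : Subgroup (GL (Fin n) ℂ)) :
    Subgroup (GL (Fin n) ℂ) :=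
  H.map (MulAut.conj P).toMonoidHom

/-- The copy `D_{p,q} O(p,q) D_{p,q}⁻¹` of `O(p, q)` inside `O(n, ℂ)`. -/
def Opq' {p q n : ℕ} (h : p + q = n) : Subgroup (GL (Fin n) ℂ) := conjSubgroup (matD h) (Opq h)

/-- The copy `D_{p,q} SO(p,q) D_{p,q}⁻¹` of `SO(p, q)` inside `SO(n, ℂ)`. -/
def SOpq' {p q n : ℕ} (h : p + q = n) : Subgroup (GL (Fin n) ℂ) := conjSubgroup (matD h) (SOpq h)

/-- `O(m, ℍ)`: the matrices `M` in `O(2m, ℂ)` with `J M = M̄ J`; this condition is the complex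
conjugate of the one that defines `GL(m, ℍ)`. -/
def OH {m n : ℕ} (h : m + m = n) : Subgroup (GL (Fin n) ℂ) := OC n ⊓ GLH h

/-- `SO(m, ℍ)`. -/
def SOH {m n : ℕ} (h : m + m = n) : Subgroup (GL (Fin n) ℂ) := OH h ⊓ SLC n

/-! ### Classical complex groups and their real forms -/

/-- The five families of classical complex groups. -/
inductive ClassicalType
  | GL
  | SL
  | O
  | SO
  | Sp

/-- The size of the matrices: `2n` for `Sp(2n, ℂ)` and `n` for the other families. -/
def ClassicalType.dim : ClassicalType → ℕ → ℕ
  | .Sp, n => 2 * n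
  | _, n => n

/-- `GL(n, ℂ)`, `SL(n, ℂ)`, `O(n, ℂ)`, `SO(n, ℂ)` and `Sp(2n, ℂ)`. -/
def ClassicalType.group : (T : ClassicalType) → (n : ℕ) → Subgroup (GL (Fin (T.dim n)) ℂ)
  | .GL, _ => ⊤
  | .SL, n => SLC n
  | .O, n => OC n
  | .SO, n => SOC n
  | .Sp, n => SpC (two_mul n).symm

/-- `IsRealForm T n P₀ R`: the group `R` is in the list of real forms of the classical group
`T.group n`. The matrix `P₀` serves only to define `SO⁻(m, ℍ) = P₀ SO(m, ℍ) P₀⁻¹` for even `m`. -/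
def IsRealForm : (T : ClassicalType) → (n : ℕ) → GL (Fin (T.dim n)) ℂ →
    Subgroup (GL (Fin (T.dim n)) ℂ) → Prop
  | .GL, n, _, R =>
      R = GLR n ∨
      (∃ (m : ℕ) (h : m + m = n), R = GLH h) ∨
      (∃ (p q : ℕ) (h : p + q = n), q ≤ p ∧ R = U h)
  | .SL, n, _, R =>
      R = GLR n ⊓ SLC n ∨
      (∃ (m : ℕ) (h : m + m = n), R = GLH h ⊓ SLC n) ∨
      (∃ (p q : ℕ) (h : p + q = n), q ≤ p ∧ R = U h ⊓ SLC n)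
  | .O, n, _, R =>
      (∃ (m : ℕ) (h : m + m = n), R = OH h) ∨
      (∃ (p q : ℕ) (h : p + q = n), q ≤ p ∧ R = Opq' h)
  | .SO, n, P₀, R =>
      (∃ (m : ℕ) (h : m + m = n), R = SOH h) ∨
      (∃ (m : ℕ) (h : m + m = n), Even m ∧ R = conjSubgroup P₀ (SOH h)) ∨
      (∃ (p q : ℕ) (h : p + q = n), q ≤ p ∧ R = SOpq' h)
  | .Sp, n, _, R =>
      R = SpR (two_mul n).symm ∨
      (∃ (p q : ℕ) (h : p + q = n), q ≤ p ∧ R = Sppq h (two_mul n).symm)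

/-! ### Character varieties -/

section CharacterVariety

variable (Γ : Type*) [Group Γ] {n : ℕ} (G : Subgroup (GL (Fin n) ℂ))

/-- The ring of regular functions on `Hom(Γ, G)`, generated by the functions `ρ ↦ ρ(γ)ᵢⱼ`.
(The functions `1 / det ρ(γ) = det ρ(γ⁻¹)` belong to it.) -/
def regularFunctions : Subalgebra ℂ ((Γ →* G) → ℂ) :=
  Algebra.adjoin ℂ {f | ∃ (γ : Γ) (i j : Fin n), f = fun ρ => (ρ γ : GL (Fin n) ℂ) i j}

variable {Γ G}

/-- The action of `G` on `Hom(Γ, G)` by conjugation, `γ ↦ P ρ(γ) P⁻¹`. -/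
def conjRep (P : G) (ρ : Γ →* G) : Γ →* G := (MulAut.conj P).toMonoidHom.comp ρ

variable (Γ G)

/-- The ring of regular functions on `Hom(Γ, G)` that are invariant by conjugation by `G`. -/
def invariantFunctions : Subalgebra ℂ ((Γ →* G) → ℂ) where
  carrier := {f | f ∈ regularFunctions Γ G ∧ ∀ (P : G) (ρ : Γ →* G), f (conjRep P ρ) = f ρ}
  mul_mem' := by
    rintro f g ⟨hf, hf'⟩ ⟨hg, hg'⟩
    exact ⟨mul_mem hf hg, fun P ρ => by simp [hf', hg']⟩
  add_mem' := by
    rintro f g ⟨hf, hf'⟩ ⟨hg, hg'⟩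
    exact ⟨add_mem hf hg, fun P ρ => by simp [hf', hg']⟩
  algebraMap_mem' := fun c => ⟨Subalgebra.algebraMap_mem _ c, fun P ρ => by simp⟩

/-- The character variety `Hom(Γ, G)//G`: the set of complex points of the spectrum of the ring of
invariant regular functions. -/
abbrev CharacterVariety := invariantFunctions Γ G →ₐ[ℂ] ℂ

variable {Γ G}

/-- The point `χ_ρ` of the character variety below `ρ`: evaluation at `ρ`. -/
def chi (ρ : Γ →* G) : CharacterVariety Γ G :=
  (Pi.evalAlgHom ℂ (fun _ => ℂ) ρ).comp (invariantFunctions Γ G).val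

/-- `ρ` is irreducible: the only subspaces of `ℂⁿ` stable by the image of `ρ` are `0` and `ℂⁿ`. -/
def IsIrreducibleRep (ρ : Γ →* G) : Prop :=
  ∀ W : Submodule ℂ (Fin n → ℂ),
    (∀ (γ : Γ), ∀ w ∈ W, (ρ γ : GL (Fin n) ℂ).val *ᵥ w ∈ W) → W = ⊥ ∨ W = ⊤

end CharacterVariety

/-! ### The two involutions -/

/-- The two involutions `A ↦ Ā` and `A ↦ (ᵗĀ)⁻¹`. -/
inductive InvolutionType
  | conj
  | conjTransposeInv

/-- The involution of `GL(n, ℂ)` of the given type. -/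
def InvolutionType.hom (n : ℕ) : InvolutionType → (GL (Fin n) ℂ →* GL (Fin n) ℂ)
  | .conj => conjHom n
  | .conjTransposeInv => conjTransposeInvHom n

theorem InvolutionType.hom_hom {n : ℕ} (t : InvolutionType) (A : GL (Fin n) ℂ) :
    t.hom n (t.hom n A) = A := by
  cases t
  · ext i j
    simp [InvolutionType.hom, conjHom]
  · simp [InvolutionType.hom, conjTransposeInvHom]

theorem matJ_map_star {m n : ℕ} (h : m + m = n) : (matJ h).map (starRingEnd ℂ) = matJ h := by
  ext i j
  simp only [matJ, reindex_apply, submatrix_apply, Matrix.map_apply]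
  rcases (blockEquiv h).symm i with a | a <;> rcases (blockEquiv h).symm j with b | b <;>
    simp [Matrix.one_apply, apply_ite (starRingEnd ℂ)]

theorem matJ_mul_matJ {m n : ℕ} (h : m + m = n) : matJ h * ((-1 : ℂ) • matJ h) = 1 := by
  have : fromBlocks (0 : Matrix (Fin m) (Fin m) ℂ) (1 : Matrix (Fin m) (Fin m) ℂ)
      (-1 : Matrix (Fin m) (Fin m) ℂ) (0 : Matrix (Fin m) (Fin m) ℂ) *
      fromBlocks 0 1 (-1) 0 = -1 := by
    rw [fromBlocks_multiply, ← fromBlocks_one, fromBlocks_neg]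
    simp
  rw [Matrix.mul_smul, matJ, reindex_apply, submatrix_mul_equiv, this]
  ext i j
  by_cases hij : i = j <;> simp [Matrix.one_apply, hij]

theorem InvolutionType.hom_mem_bilinGroup {n : ℕ} (t : InvolutionType)
    {B : Matrix (Fin n) (Fin n) ℂ} {c : ℂ} (hc : c ≠ 0) (hB : B * (c • B) = 1)
    (hB' : B.map (starRingEnd ℂ) = B) {A : GL (Fin n) ℂ} (hA : A ∈ bilinGroup B) :
    t.hom n A ∈ bilinGroup B := by
  have hA' : A.valᵀ * B * A.val = B := hA
  cases t
  · change (A.val.map (starRingEnd ℂ))ᵀ * B * (A.val.map (starRingEnd ℂ)) = B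
    have := congrArg (fun M : Matrix (Fin n) (Fin n) ℂ => M.map (starRingEnd ℂ)) hA'
    simpa only [Matrix.map_mul, hB', ← transpose_map] using this
  · have h1 : (A.valᵀ * B) * (A.val * (c • B)) = 1 := by
      rw [← Matrix.mul_assoc, hA', hB]
    have h2 : A.val * (c • B) * (A.valᵀ * B) = 1 := mul_eq_one_comm.mp h1
    have h3 : A.val * (c • B) * A.valᵀ = c • B := by
      calc A.val * (c • B) * A.valᵀ = A.val * (c • B) * A.valᵀ * (B * (c • B)) := by
            rw [hB, Matrix.mul_one]
        _ = A.val * (c • B) * (A.valᵀ * B) * (c • B) := by simp only [Matrix.mul_assoc]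
        _ = c • B := by rw [h2, Matrix.one_mul]
    have h4 : A.val * B * A.valᵀ = B := by
      rw [Matrix.mul_smul, Matrix.smul_mul] at h3
      exact smul_right_injective _ hc h3
    have h5 : (star A)⁻¹⁻¹ ∈ bilinGroup B := by
      rw [inv_inv]
      change (star A.val)ᵀ * B * star A.val = B
      have := congrArg (fun M : Matrix (Fin n) (Fin n) ℂ => M.map (starRingEnd ℂ)) h4
      simp only [Matrix.map_mul, hB'] at this
      exact this
    exact inv_mem_iff.mp h5

theorem InvolutionType.hom_mem_SLC {n : ℕ} (t : InvolutionType) {A : GL (Fin n) ℂ}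
    (hA : A ∈ SLC n) : t.hom n A ∈ SLC n := by
  have hA' : A.val.det = 1 := congrArg Units.val (MonoidHom.mem_ker.mp hA)
  cases t
  · apply MonoidHom.mem_ker.mpr
    ext
    change (A.val.map (starRingEnd ℂ)).det = 1
    have := RingHom.map_det (starRingEnd ℂ) A.val
    rw [hA', map_one] at this
    exact this.symm
  · have : star A ∈ SLC n := by
      apply MonoidHom.mem_ker.mpr
      ext
      change (star A.val).det = 1
      rw [star_eq_conjTranspose, det_conjTranspose, hA', star_one]
    exact inv_mem this

theorem InvolutionType.hom_mem_OC {n : ℕ} (t : InvolutionType) {A : GL (Fin n) ℂ}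
    (hA : A ∈ OC n) : t.hom n A ∈ OC n :=
  t.hom_mem_bilinGroup one_ne_zero (by simp) (by simp) hA

/-- The classical groups are stable by the two involutions. -/
theorem InvolutionType.hom_mem (t : InvolutionType) (T : ClassicalType) (n : ℕ)
    {A : GL (Fin (T.dim n)) ℂ} (hA : A ∈ T.group n) : t.hom (T.dim n) A ∈ T.group n := by
  cases T
  · exact Subgroup.mem_top _
  · exact t.hom_mem_SLC hA
  · exact t.hom_mem_OC hA
  · exact ⟨t.hom_mem_SLC hA.1, t.hom_mem_OC hA.2⟩
  · exact t.hom_mem_bilinGroup (neg_ne_zero.mpr one_ne_zero) (matJ_mul_matJ _)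
      (matJ_map_star _) hA

/-- The involution of the classical group `T.group n`. -/
def InvolutionType.groupHom (t : InvolutionType) (T : ClassicalType) (n : ℕ) :
    T.group n →* T.group n :=
  ((t.hom (T.dim n)).comp (T.group n).subtype).codRestrict (T.group n)
    fun A => t.hom_mem T n A.2

section Involution

variable {Γ : Type*} [Group Γ] (t : InvolutionType) (T : ClassicalType) (n : ℕ)

theorem InvolutionType.groupHom_groupHom (A : T.group n) :
    t.groupHom T n (t.groupHom T n A) = A :=
  Subtype.ext (t.hom_hom A.1)

/-- The function `ρ ↦ conj (f (φ ∘ ρ))` on `Hom(Γ, G)`, where `φ` is the involution of `G`. -/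
def twist (f : (Γ →* T.group n) → ℂ) : (Γ →* T.group n) → ℂ :=
  fun ρ => starRingEnd ℂ (f ((t.groupHom T n).comp ρ))

theorem twist_mem_regularFunctions {f : (Γ →* T.group n) → ℂ}
    (hf : f ∈ regularFunctions Γ (T.group n)) :
    twist t T n f ∈ regularFunctions Γ (T.group n) := by
  induction hf using Algebra.adjoin_induction with
  | mem f hf =>
    obtain ⟨γ, i, j, rfl⟩ := hf
    apply Algebra.subset_adjoin
    cases t
    · refine ⟨γ, i, j, ?_⟩
      funext ρ
      change starRingEnd ℂ (starRingEnd ℂ ((ρ γ).1.val i j)) = (ρ γ).1.val i j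
      simp
    · refine ⟨γ⁻¹, j, i, ?_⟩
      funext ρ
      have h : (star (ρ γ).1)⁻¹ = star (ρ γ⁻¹).1 := by simp
      change starRingEnd ℂ (((star (ρ γ).1)⁻¹).val i j) = (ρ γ⁻¹).1.val j i
      rw [h]
      change starRingEnd ℂ (starRingEnd ℂ ((ρ γ⁻¹).1.val j i)) = _
      simp
  | algebraMap c =>
    exact Subalgebra.algebraMap_mem (regularFunctions Γ (T.group n)) (starRingEnd ℂ c)
  | add f g _ _ hf hg =>
    have : twist t T n (f + g) = twist t T n f + twist t T n g := by
      funext ρ; simp [twist]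
    rw [this]; exact add_mem hf hg
  | mul f g _ _ hf hg =>
    have : twist t T n (f * g) = twist t T n f * twist t T n g := by
      funext ρ; simp [twist]
    rw [this]; exact mul_mem hf hg

theorem twist_mem_invariantFunctions {f : (Γ →* T.group n) → ℂ}
    (hf : f ∈ invariantFunctions Γ (T.group n)) :
    twist t T n f ∈ invariantFunctions Γ (T.group n) := by
  refine ⟨twist_mem_regularFunctions t T n hf.1, fun P ρ => ?_⟩
  have h : (t.groupHom T n).comp (conjRep P ρ) =
      conjRep (t.groupHom T n P) ((t.groupHom T n).comp ρ) := by
    ext1 γ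
    simp [conjRep]
  simp only [twist]
  rw [h, hf.2]

/-- The anti-holomorphic involution `Φ` of the character variety: the pull-back of an invariant
function `f` by `Φ` is the complex conjugate of the invariant function `twist f`. -/
def Phi (x : CharacterVariety Γ (T.group n)) : CharacterVariety Γ (T.group n) where
  toFun f := starRingEnd ℂ (x ⟨twist t T n f.1, twist_mem_invariantFunctions t T n f.2⟩)
  map_one' := by
    have : (⟨twist t T n 1, twist_mem_invariantFunctions t T n (one_mem _)⟩ :
        invariantFunctions Γ (T.group n)) = 1 := by
      ext ρ; simp [twist]
    change starRingEnd ℂ (x ⟨twist t T n 1, _⟩) = 1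
    rw [this]; simp
  map_mul' f g := by
    rw [← map_mul, ← map_mul]
    congr 2
    ext ρ; simp [twist]
  map_zero' := by
    have : (⟨twist t T n 0, twist_mem_invariantFunctions t T n (zero_mem _)⟩ :
        invariantFunctions Γ (T.group n)) = 0 := by
      ext ρ; simp [twist]
    change starRingEnd ℂ (x ⟨twist t T n 0, _⟩) = 0
    rw [this]; simp
  map_add' f g := by
    rw [← map_add, ← map_add]
    congr 2
    ext ρ; simp [twist]
  commutes' c := by
    have : (⟨twist t T n (algebraMap ℂ (invariantFunctions Γ (T.group n)) c).1,
        twist_mem_invariantFunctions t T n (Subtype.prop _)⟩ :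
        invariantFunctions Γ (T.group n)) = algebraMap ℂ _ (starRingEnd ℂ c) := by
      ext ρ; simp [twist]
    rw [this, AlgHom.commutes]
    simp

/-- `Φ` is induced by the involution of the group: it maps `χ_ρ` to `χ_{φ ∘ ρ}`. -/
theorem Phi_chi (ρ : Γ →* T.group n) :
    Phi t T n (chi ρ) = chi ((t.groupHom T n).comp ρ) := by
  ext f
  change starRingEnd ℂ (starRingEnd ℂ (f.1 ((t.groupHom T n).comp ρ))) = _
  simp [chi]

theorem Phi_Phi (x : CharacterVariety Γ (T.group n)) : Phi t T n (Phi t T n x) = x := by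
  ext f
  change starRingEnd ℂ (starRingEnd ℂ (x ⟨twist t T n (twist t T n f.1), _⟩)) = _
  rw [Complex.conj_conj]
  congr 1
  ext ρ
  have h : (t.groupHom T n).comp ((t.groupHom T n).comp ρ) = ρ := by
    ext1 γ
    exact t.groupHom_groupHom T n (ρ γ)
  simp [twist, h]

end Involution

end

end CharVar

open CharVar

namespace CharVar

noncomputable section

/-! ### Irreducible representations and their characters -/

section

/-! Let f be the representation and φ the involution. The traces of the f(γ) are invariant
functions, so `Phi t T n (chi ρ) = chi ρ` says that f and φ ∘ f have the same character. By
Burnside's theorem an irreducible f maps the group algebra onto all matrices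
(`groupAlgHom_surjective`), and then the character determines f up to conjugation
(`exists_conj_of_trace_eq`). So some X satisfies φ(f(γ)) = X f(γ) X⁻¹. Schur's lemma restricts X
severely, and the real form is read off from X.

For φ = conjugation, X̄X is a real scalar, normalized to ±1. Hilbert's theorem 90 writes X as a
twisted coboundary: a matrix S with S̄X = S (sign +) or JS̄X = S (sign -) conjugates f into the real
or the quaternionic group. For φ = inverse conjugate transpose, X is an f-invariant sesquilinear
form, Hermitian up to a scalar, and Sylvester's law puts f in some U(p,q). This settles GL, and SL
follows by scaling the conjugator to determinant 1.

On O, SO and Sp the two involutions are conjugate by the matrix of the bilinear form B, so they give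
the same condition on traces and only conjugation has to be treated. Uniqueness of invariant forms
lets X be taken in the group of B, with X̄X = ±1. The difficulty is to keep the conjugator in that
group. For the sign +, S transports B to a real form, which is then put in standard shape by a real
change of basis: Sylvester's law for O, the real normal form of alternating matrices for Sp. For the
sign -, one diagonalizes a Hermitian matrix, iX for O and JX for Sp, in an orthonormal basis of
pairs (v, j v) for a suitable antiunitary j (`exists_paired_diagonalization`); such a basis controls
the Hermitian and bilinear structures at once.

For SO, a conjugator of determinant -1 is corrected by an orthogonal matrix of determinant -1 that
normalizes the real form. For O(m,ℍ) with m even the correction is made by P₀ instead, and this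
produces SO⁻(m,ℍ). -/

/-- **Burnside's theorem**. -/
theorem subalgebra_eq_top_of_irreducible {V : Type*} [AddCommGroup V] [Module ℂ V]
    [FiniteDimensional ℂ V] [Nontrivial V] (S : Subalgebra ℂ (Module.End ℂ V))
    (hS : ∀ W : Submodule ℂ V, (∀ a ∈ S, ∀ w ∈ W, a w ∈ W) → W = ⊥ ∨ W = ⊤) : S = ⊤ := by
  have simple : IsSimpleModule S V := by
    rw [isSimpleModule_iff]
    refine { eq_bot_or_eq_top := fun W => ?_ }
    rcases hS (W.restrictScalars ℂ) (fun a ha w hw => W.smul_mem ⟨a, ha⟩ hw) with h | h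
    · left; simpa using h
    · right; simpa using h
  rw [eq_top_iff]
  intro M _
  -- By Schur's lemma the `S`-endomorphisms are scalars, so every linear `M` commutes with them.
  -- Jacobson density on a finite basis then gives an element of `S` equal to `M`.
  have scal : ∀ e : Module.End S V, ∃ c : ℂ, ∀ v, e v = c • v := by
    intro e
    obtain ⟨c, rfl⟩ := (IsSimpleModule.algebraMap_end_bijective_of_isAlgClosed (A := S) (V := V) ℂ).2 e
    exact ⟨c, fun v => rfl⟩
  let f : Module.End (Module.End S V) V :=
    { toFun := M
      map_add' := map_add M
      map_smul' := fun e v => by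
        obtain ⟨c, hc⟩ := scal e
        simp [hc] }
  let b := Module.finBasis ℂ V
  obtain ⟨r, hr⟩ := jacobson_density f (Set.finite_range b).toFinset
  have : M = r.1 := b.ext fun i => hr (b i) (by simp)
  rw [this]; exact r.2

variable {Γ : Type*} [Group Γ] {n : ℕ}

/-- The linear extension of `f : Γ → GL(n, ℂ)` to the group algebra. -/
def groupAlgHom (f : Γ →* GL (Fin n) ℂ) : MonoidAlgebra ℂ Γ →ₐ[ℂ] Matrix (Fin n) (Fin n) ℂ :=
  MonoidAlgebra.lift ℂ _ Γ ((Units.coeHom _).comp f)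

@[simp] theorem groupAlgHom_of (f : Γ →* GL (Fin n) ℂ) (γ : Γ) :
    groupAlgHom f (MonoidAlgebra.of ℂ Γ γ) = (f γ).val := by
  simp [groupAlgHom]

/-- This surjectivity is the form in which irreducibility is used everywhere below. -/
theorem groupAlgHom_surjective (hn : 0 < n) (f : Γ →* GL (Fin n) ℂ)
    (hf : ∀ W : Submodule ℂ (Fin n → ℂ), (∀ γ, ∀ w ∈ W, (f γ).val *ᵥ w ∈ W) → W = ⊥ ∨ W = ⊤) :
    Function.Surjective (groupAlgHom f) := by
  have : Nonempty (Fin n) := ⟨⟨0, hn⟩⟩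
  let F := (Matrix.toLinAlgEquiv' (R := ℂ) (n := Fin n)).toAlgHom.comp (groupAlgHom f)
  have : F.range = ⊤ := by
    refine subalgebra_eq_top_of_irreducible _ fun W hW => hf W fun γ w hw => ?_
    have := hW (F (MonoidAlgebra.of ℂ Γ γ)) ⟨_, rfl⟩ w hw
    simpa [F, -MonoidAlgebra.of_apply] using this
  intro M
  have hM : Matrix.toLinAlgEquiv' M ∈ F.range := this ▸ trivial
  obtain ⟨x, hx⟩ := hM
  exact ⟨x, Matrix.toLinAlgEquiv'.injective hx⟩

/-- **Schur's lemma**. -/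
theorem exists_scalar_of_commute (f : Γ →* GL (Fin n) ℂ) (hf : Function.Surjective (groupAlgHom f))
    (M : Matrix (Fin n) (Fin n) ℂ) (hM : ∀ γ, M * (f γ).val = (f γ).val * M) :
    ∃ c : ℂ, M = c • 1 := by
  have key : ∀ x, M * groupAlgHom f x = groupAlgHom f x * M := by
    intro x
    induction x using MonoidAlgebra.induction_on with
    | of γ => simpa [-MonoidAlgebra.of_apply] using hM γ
    | add x y hx hy => simp [mul_add, add_mul, hx, hy]
    | smul c x hx => simp [hx]
  have : M ∈ Set.range (Matrix.scalar (Fin n)) := by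
    refine mem_range_scalar_of_commute_single fun i j _ => ?_
    obtain ⟨x, hx⟩ := hf (Matrix.single i j 1)
    rw [← hx]; exact (key x).symm
  obtain ⟨c, rfl⟩ := this
  exact ⟨c, by ext i j; simp [Matrix.scalar_apply, Matrix.one_apply, Matrix.diagonal_apply]⟩

theorem trace_groupAlgHom (f g : Γ →* GL (Fin n) ℂ) (h : ∀ γ, (f γ).val.trace = (g γ).val.trace)
    (x : MonoidAlgebra ℂ Γ) : (groupAlgHom f x).trace = (groupAlgHom g x).trace := by
  induction x using MonoidAlgebra.induction_on with
  | of γ => simpa [-MonoidAlgebra.of_apply] using h γ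
  | add x y hx hy => simp [hx, hy]
  | smul c x hx => simp [hx]

/-- The trace form is nondegenerate and every matrix is some g(y), so it suffices that tr g(xy) = tr
f(xy) = 0. -/
theorem groupAlgHom_eq_zero (f g : Γ →* GL (Fin n) ℂ) (hg : Function.Surjective (groupAlgHom g))
    (h : ∀ γ, (f γ).val.trace = (g γ).val.trace) (x : MonoidAlgebra ℂ Γ)
    (hx : groupAlgHom f x = 0) : groupAlgHom g x = 0 := by
  apply Matrix.ext_iff_trace_mul_right.mpr
  intro Y
  obtain ⟨y, rfl⟩ := hg Y
  rw [← map_mul, ← trace_groupAlgHom f g h]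
  simp [hx]

/-- Two irreducible representations with the same character are conjugate. -/
theorem exists_conj_of_trace_eq (f g : Γ →* GL (Fin n) ℂ)
    (hf : Function.Surjective (groupAlgHom f)) (hg : Function.Surjective (groupAlgHom g))
    (h : ∀ γ, (f γ).val.trace = (g γ).val.trace) :
    ∃ X : GL (Fin n) ℂ, ∀ γ, g γ = X * f γ * X⁻¹ := by
  -- Since the kernel of f lies in that of g, g factors through f: composing g with a linear section
  -- `s` of f gives an algebra automorphism `θ` of the matrices. It is inner by the Skolem–Noether
  -- theorem, and the conjugating matrix is `X`.
  obtain ⟨s, hs⟩ := (groupAlgHom f).toLinearMap.exists_rightInverse_of_surjective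
    (LinearMap.range_eq_top.mpr hf)
  have hs' : ∀ M, groupAlgHom f (s M) = M := fun M => LinearMap.congr_fun hs M
  let θ : Matrix (Fin n) (Fin n) ℂ →ₗ[ℂ] Matrix (Fin n) (Fin n) ℂ :=
    (groupAlgHom g).toLinearMap.comp s
  have hθ : ∀ x, θ (groupAlgHom f x) = groupAlgHom g x := by
    intro x
    have := groupAlgHom_eq_zero f g hg h (s (groupAlgHom f x) - x) (by simp [hs'])
    rw [map_sub, sub_eq_zero] at this
    exact this
  have h1 : θ 1 = 1 := by simpa using hθ 1
  have hmul : ∀ M N, θ (M * N) = θ M * θ N := by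
    intro M N
    obtain ⟨x, rfl⟩ := hf M
    obtain ⟨y, rfl⟩ := hf N
    rw [← map_mul, hθ, hθ, hθ, map_mul]
  have hsurj : Function.Surjective θ := fun M => by
    obtain ⟨x, rfl⟩ := hg M
    exact ⟨_, hθ x⟩
  have hinj : Function.Injective θ := LinearMap.injective_iff_surjective.mpr hsurj
  let Θ := AlgEquiv.ofBijective (AlgHom.ofLinearMap θ h1 hmul) ⟨hinj, hsurj⟩
  let E := Matrix.toLinAlgEquiv' (R := ℂ) (n := Fin n)
  obtain ⟨T, hT⟩ := ((E.symm.trans Θ).trans E).eq_linearEquivConjAlgEquiv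
  let A := LinearMap.toMatrix' T.toLinearMap
  let B := LinearMap.toMatrix' T.symm.toLinearMap
  have hAB : A * B = 1 := by simp [A, B, ← LinearMap.toMatrix'_comp]
  refine ⟨⟨A, B, hAB, mul_eq_one_comm.mp hAB⟩, fun γ => Units.ext ?_⟩
  have h2 := hθ (MonoidAlgebra.of ℂ Γ γ)
  rw [groupAlgHom_of, groupAlgHom_of] at h2
  have h3 := congrArg E.symm (DFunLike.congr_fun hT (E (f γ).val))
  change _ = A * (f γ).val * B
  rw [← h2]
  have h4 : E.symm (((E.symm.trans Θ).trans E) (E (f γ).val)) = θ (f γ).val := by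
    simp only [AlgEquiv.trans_apply, AlgEquiv.symm_apply_apply]
    rfl
  rw [← h4, h3]
  have hA : E A = T.toLinearMap := Matrix.toLin'_toMatrix' _
  have hB : E B = T.symm.toLinearMap := Matrix.toLin'_toMatrix' _
  apply E.injective
  rw [AlgEquiv.apply_symm_apply, map_mul, map_mul, hA, hB]
  rfl

/-- The image of `groupAlgHom g` contains the image under `σ` of that of `groupAlgHom f`. The map
`e` is only a relabelling of Γ: it will be the identity or the inversion. -/
theorem groupAlgHom_surjective_of_semilinear (f g : Γ →* GL (Fin n) ℂ) (e : Γ → Γ)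
    (σ : Matrix (Fin n) (Fin n) ℂ →ₛₗ[starRingEnd ℂ] Matrix (Fin n) (Fin n) ℂ)
    (hσ : Function.Surjective σ) (h : ∀ γ, σ (f γ).val = (g (e γ)).val)
    (hf : Function.Surjective (groupAlgHom f)) : Function.Surjective (groupAlgHom g) := by
  have key : ∀ x, ∃ y, groupAlgHom g y = σ (groupAlgHom f x) := by
    intro x
    induction x using MonoidAlgebra.induction_on with
    | of γ => exact ⟨MonoidAlgebra.of ℂ Γ (e γ), by rw [groupAlgHom_of, groupAlgHom_of, h]⟩
    | add x y hx hy =>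
      obtain ⟨a, ha⟩ := hx
      obtain ⟨b, hb⟩ := hy
      exact ⟨a + b, by rw [map_add, map_add, map_add, ha, hb]⟩
    | smul c x hx =>
      obtain ⟨a, ha⟩ := hx
      exact ⟨starRingEnd ℂ c • a, by rw [map_smul, map_smul, ha, map_smulₛₗ]⟩
  intro M
  obtain ⟨N, rfl⟩ := hσ M
  obtain ⟨x, rfl⟩ := hf N
  exact key x

theorem groupAlgHom_involution_surjective (t : InvolutionType) (f : Γ →* GL (Fin n) ℂ)
    (hf : Function.Surjective (groupAlgHom f)) :
    Function.Surjective (groupAlgHom ((t.hom n).comp f)) := by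
  cases t
  · refine groupAlgHom_surjective_of_semilinear f _ id
      { toFun := fun M => M.map (starRingEnd ℂ)
        map_add' := fun M N => by ext; simp
        map_smul' := fun c M => by ext; simp } (fun M => ⟨M.map (starRingEnd ℂ), ?_⟩) (fun γ => rfl) hf
    ext; simp
  -- The map A ↦ (A*)⁻¹ is not additive, but A ↦ A* is, and it sends f(γ) to the value of the
  -- twisted representation at γ⁻¹.
  · refine groupAlgHom_surjective_of_semilinear f _ (fun γ => γ⁻¹)
      { toFun := fun M => Mᴴ
        map_add' := fun M N => by simp
        map_smul' := fun c M => by simp } (fun M => ⟨Mᴴ, by simp⟩) (fun γ => ?_) hf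
    change (f γ).valᴴ = ((star (f γ⁻¹))⁻¹).val
    rw [map_inv, star_inv, inv_inv]
    rfl

/-! ### Traces as invariant functions -/

theorem trace_mem_invariantFunctions (G : Subgroup (GL (Fin n) ℂ)) (γ : Γ) :
    (fun ρ : Γ →* G => (ρ γ : GL (Fin n) ℂ).val.trace) ∈ invariantFunctions Γ G := by
  refine ⟨?_, fun P ρ => ?_⟩
  · have : (fun ρ : Γ →* G => (ρ γ : GL (Fin n) ℂ).val.trace) =
        ∑ i, fun ρ : Γ →* G => (ρ γ : GL (Fin n) ℂ) i i := by
      ext ρ; simp [Matrix.trace]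
    rw [this]
    exact sum_mem fun i _ => Algebra.subset_adjoin ⟨γ, i, i, rfl⟩
  · change ((P : GL (Fin n) ℂ).val * (ρ γ : GL (Fin n) ℂ).val *
      ((P⁻¹ : G) : GL (Fin n) ℂ).val).trace = _
    rw [Matrix.trace_mul_cycle]
    have : ((P⁻¹ : G) : GL (Fin n) ℂ).val * (P : GL (Fin n) ℂ).val = 1 :=
      (P : GL (Fin n) ℂ).inv_mul
    rw [this, Matrix.one_mul]

/-- This is all that the proof retains of the hypothesis on the character variety. -/
theorem trace_eq_of_Phi_chi_eq (t : InvolutionType) (T : ClassicalType) (N : ℕ)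
    (ρ : Γ →* T.group N) (h : Phi t T N (chi ρ) = chi ρ) (γ : Γ) :
    (ρ γ).1.val.trace = (t.hom _ (ρ γ).1).val.trace := by
  rw [Phi_chi] at h
  have := DFunLike.congr_fun h ⟨_, trace_mem_invariantFunctions (T.group N) γ⟩
  exact this.symm

/-- On the group of a bilinear form, `A ↦ (ᵗĀ)⁻¹` and `A ↦ Ā` have the same trace. -/
theorem trace_hom_of_mem_bilinGroup (t : InvolutionType) {B : GL (Fin n) ℂ}
    (hB : B.val.map (starRingEnd ℂ) = B.val) {A : GL (Fin n) ℂ} (hA : A ∈ bilinGroup B.val) :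
    (t.hom n A).val.trace = (A.val.map (starRingEnd ℂ)).trace := by
  cases t
  · rfl
  · have hA' : (A.val.map (starRingEnd ℂ))ᵀ * B.val * A.val.map (starRingEnd ℂ) = B.val := by
      have := congrArg (fun M : Matrix (Fin n) (Fin n) ℂ => M.map (starRingEnd ℂ))
        (show A.valᵀ * B.val * A.val = B.val from hA)
      simpa only [Matrix.map_mul, hB, ← transpose_map] using this
    have h1 : ((star A)⁻¹).val * (star A).val = 1 := (star A).inv_mul
    have h2 : (star A).val = (A.val.map (starRingEnd ℂ))ᵀ := rfl
    rw [h2] at h1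
    -- Since Ā also preserves the real form B, it is conjugate to (A*)⁻¹ by B.
    have h3 : B.val * A.val.map (starRingEnd ℂ) = ((star A)⁻¹).val * B.val := by
      conv_rhs => rw [← hA']
      rw [← Matrix.mul_assoc, ← Matrix.mul_assoc, h1, Matrix.one_mul]
    change ((star A)⁻¹).val.trace = _
    calc ((star A)⁻¹).val.trace = (((star A)⁻¹).val * B.val * (B⁻¹).val).trace := by
          rw [Matrix.mul_assoc, show B.val * (B⁻¹).val = 1 from B.mul_inv, Matrix.mul_one]
      _ = _ := by
        rw [← h3, Matrix.trace_mul_cycle, show (B⁻¹).val * B.val = 1 from B.inv_mul, Matrix.one_mul]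


end

section

/-! ### Complex conjugation of matrices -/

section Conj

variable {l m k : Type*}

/-- The complex conjugate of a matrix. -/
def mbar (M : Matrix l m ℂ) : Matrix l m ℂ := M.map (starRingEnd ℂ)

@[simp] theorem mbar_apply (M : Matrix l m ℂ) (i : l) (j : m) :
    mbar M i j = starRingEnd ℂ (M i j) := rfl

@[simp] theorem mbar_mbar (M : Matrix l m ℂ) : mbar (mbar M) = M := by ext; simp

@[simp] theorem mbar_mul [Fintype m] (M : Matrix l m ℂ) (N : Matrix m k ℂ) :
    mbar (M * N) = mbar M * mbar N := Matrix.map_mul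

@[simp] theorem mbar_smul (c : ℂ) (M : Matrix l m ℂ) :
    mbar (c • M) = starRingEnd ℂ c • mbar M := by ext; simp

@[simp] theorem mbar_neg (M : Matrix l m ℂ) : mbar (-M) = -mbar M := by ext; simp

@[simp] theorem mbar_add (M N : Matrix l m ℂ) : mbar (M + N) = mbar M + mbar N := by ext; simp

@[simp] theorem mbar_one [DecidableEq l] : mbar (1 : Matrix l l ℂ) = 1 := by
  ext i j; by_cases h : i = j <;> simp [h, Matrix.one_apply]

theorem mbar_transpose (M : Matrix l m ℂ) : (mbar M)ᵀ = Mᴴ := rfl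

theorem mbar_conjTranspose (M : Matrix l m ℂ) : mbar Mᴴ = Mᵀ := by ext; simp

theorem conjTranspose_mbar (M : Matrix l m ℂ) : (mbar M)ᴴ = Mᵀ := by ext; simp

theorem transpose_mbar (M : Matrix l m ℂ) : mbar Mᵀ = Mᴴ := rfl

theorem mbar_map_ofReal (M : Matrix l m ℝ) :
    mbar (M.map (algebraMap ℝ ℂ)) = M.map (algebraMap ℝ ℂ) := by
  ext; simp

theorem exists_map_ofReal_eq {M : Matrix l m ℂ} (h : mbar M = M) :
    ∃ R : Matrix l m ℝ, R.map (algebraMap ℝ ℂ) = M := by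
  refine ⟨fun i j => (M i j).re, ?_⟩
  ext1 i j
  exact Complex.conj_eq_iff_re.mp (congrFun (congrFun h i) j)

theorem mbar_mulVec_star [Fintype m] (M : Matrix l m ℂ) (v : m → ℂ) :
    mbar M *ᵥ star v = star (M *ᵥ v) := by
  ext i; simp [Matrix.mulVec, dotProduct]

end Conj

variable {n : ℕ}

@[simp] theorem conjHom_val (A : GL (Fin n) ℂ) : (conjHom n A).val = mbar A.val := rfl

@[simp] theorem conjHom_conjHom (A : GL (Fin n) ℂ) : conjHom n (conjHom n A) = A :=
  InvolutionType.conj.hom_hom A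

/-- `GLR n` is an image of real invertible matrices, so the inverse must be real too; it is, being
fixed by conjugation with `A`. -/
theorem mem_GLR_iff {A : GL (Fin n) ℂ} : A ∈ GLR n ↔ conjHom n A = A := by
  constructor
  · rintro ⟨R, rfl⟩
    exact Units.ext (mbar_map_ofReal R.val)
  · intro h
    have h1 : mbar A.val = A.val := congrArg Units.val h
    have h2 : mbar (A⁻¹).val = (A⁻¹).val := by
      have := congrArg Units.val (congrArg Inv.inv h)
      rw [← map_inv] at this
      exact this
    obtain ⟨R, hR⟩ := exists_map_ofReal_eq h1
    obtain ⟨R', hR'⟩ := exists_map_ofReal_eq h2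
    have inj : Function.Injective fun M : Matrix (Fin n) (Fin n) ℝ => M.map (algebraMap ℝ ℂ) :=
      Matrix.map_injective (algebraMap ℝ ℂ).injective
    have h3 : R * R' = 1 := by
      apply inj
      change (R * R').map (algebraMap ℝ ℂ) = (1 : Matrix (Fin n) (Fin n) ℝ).map (algebraMap ℝ ℂ)
      rw [Matrix.map_mul, hR, hR', Matrix.map_one _ (map_zero _) (map_one _)]
      exact A.mul_inv
    exact ⟨⟨R, R', h3, mul_eq_one_comm.mp h3⟩, Units.ext hR⟩

theorem mem_GLH_iff {m : ℕ} (h : m + m = n) {A : GL (Fin n) ℂ} :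
    A ∈ GLH h ↔ A.val * matJ h = matJ h * mbar A.val := Iff.rfl

theorem mem_bilinGroup_iff {B : Matrix (Fin n) (Fin n) ℂ} {A : GL (Fin n) ℂ} :
    A ∈ bilinGroup B ↔ A.valᵀ * B * A.val = B := Iff.rfl

theorem mem_hermGroup_iff {B : Matrix (Fin n) (Fin n) ℂ} {A : GL (Fin n) ℂ} :
    A ∈ hermGroup B ↔ A.valᴴ * B * A.val = B := Iff.rfl

theorem mem_OC_iff {A : GL (Fin n) ℂ} : A ∈ OC n ↔ A.valᵀ * A.val = 1 := by
  rw [OC, mem_bilinGroup_iff, Matrix.mul_one]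

theorem mem_SLC_iff {A : GL (Fin n) ℂ} : A ∈ SLC n ↔ A.val.det = 1 := by
  rw [SLC, MonoidHom.mem_ker, Units.ext_iff]; rfl

/-! ### The standard matrices -/

theorem matJ_sq {m : ℕ} (h : m + m = n) : matJ h * matJ h = -1 := by
  have := matJ_mul_matJ h
  rw [Matrix.mul_smul, neg_smul, one_smul] at this
  rw [← this, neg_neg]

theorem mbar_matJ {m : ℕ} (h : m + m = n) : mbar (matJ h) = matJ h := matJ_map_star h

theorem matJ_transpose {m : ℕ} (h : m + m = n) : (matJ h)ᵀ = -matJ h := by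
  rw [matJ, reindex_apply, transpose_submatrix, fromBlocks_transpose]
  ext i j
  simp only [submatrix_apply, Matrix.neg_apply]
  rcases (blockEquiv h).symm i with a | a <;> rcases (blockEquiv h).symm j with b | b <;> simp

theorem matJ_conjTranspose {m : ℕ} (h : m + m = n) : (matJ h)ᴴ = -matJ h := by
  rw [← mbar_transpose, mbar_matJ, matJ_transpose]

/-- `J_{2m}` as an invertible matrix. -/
def unitJ {m : ℕ} (h : m + m = n) : GL (Fin n) ℂ where
  val := matJ h
  inv := -matJ h
  val_inv := by rw [Matrix.mul_neg, matJ_sq, neg_neg]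
  inv_val := by rw [Matrix.neg_mul, matJ_sq, neg_neg]

@[simp] theorem unitJ_val {m : ℕ} (h : m + m = n) : (unitJ h).val = matJ h := rfl

/-- The diagonal of `I_{p,q}`. -/
def signVec {p q : ℕ} (h : p + q = n) (i : Fin n) : ℝ :=
  Sum.elim (fun _ => 1) (fun _ => -1) ((blockEquiv h).symm i)

/-- `I_{p,q}` is the diagonal matrix with diagonal `signVec`. -/
theorem matI_eq_diagonal {p q : ℕ} (h : p + q = n) :
    matI h = diagonal fun i => ((signVec h i : ℝ) : ℂ) := by
  rw [matI, reindex_apply]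
  ext i j
  rw [submatrix_apply, diagonal_apply]
  obtain ⟨a, rfl⟩ := (blockEquiv h).surjective i
  obtain ⟨b, rfl⟩ := (blockEquiv h).surjective j
  simp only [Equiv.symm_apply_apply, signVec, EmbeddingLike.apply_eq_iff_eq]
  rcases a with a | a <;> rcases b with b | b <;> simp [Matrix.one_apply, neg_ite]

theorem signVec_mul_self {p q : ℕ} (h : p + q = n) (i : Fin n) :
    signVec h i * signVec h i = 1 := by
  rw [signVec]
  rcases (blockEquiv h).symm i with a | a <;> simp

theorem matD_eq_diagonal {p q : ℕ} (h : p + q = n) :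
    (matD h).val = diagonal fun i => if signVec h i = 1 then 1 else Complex.I := by
  change reindex (blockEquiv h) (blockEquiv h) (fromBlocks 1 0 0 (Complex.I • 1)) = _
  rw [reindex_apply]
  ext i j
  rw [submatrix_apply, diagonal_apply]
  obtain ⟨a, rfl⟩ := (blockEquiv h).surjective i
  obtain ⟨b, rfl⟩ := (blockEquiv h).surjective j
  simp only [Equiv.symm_apply_apply, signVec, EmbeddingLike.apply_eq_iff_eq]
  rcases a with a | a <;> rcases b with b | b <;>
    simp [Matrix.one_apply, show (-1 : ℝ) ≠ 1 by norm_num]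

theorem matD_transpose_mul {p q : ℕ} (h : p + q = n) :
    (matD h).valᵀ * (matD h).val = matI h := by
  rw [matD_eq_diagonal, matI_eq_diagonal, diagonal_transpose, diagonal_mul_diagonal]
  congr 1
  ext i
  rcases mul_self_eq_one_iff.mp (signVec_mul_self h i) with h | h <;>
    simp [h, show (-1 : ℝ) ≠ 1 by norm_num]

/-! ### Signatures and Sylvester's law -/

/-- A family of nonzero reals can be ordered, up to a global sign, with its positive terms first and
at least as many positive terms as negative ones. -/
theorem exists_signature (s : Fin n → ℝ) (hs : ∀ i, s i ≠ 0) :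
    ∃ (p q : ℕ) (h : p + q = n) (e : Fin n ≃ Fin n) (ε : ℝ), q ≤ p ∧ (ε = 1 ∨ ε = -1) ∧
      ∀ i, ε * s (e i) = signVec h i * |s (e i)| := by
  classical
  have main : ∀ s : Fin n → ℝ, (∀ i, s i ≠ 0) →
      ∃ h : Fintype.card {i // 0 < s i} + Fintype.card {i // ¬ 0 < s i} = n, ∃ e : Fin n ≃ Fin n,
        ∀ i, s (e i) = signVec h i * |s (e i)| := by
    intro s hs
    have h : Fintype.card {i // 0 < s i} + Fintype.card {i // ¬ 0 < s i} = n := by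
      have := Fintype.card_congr (Equiv.sumCompl fun i => 0 < s i)
      simpa only [Fintype.card_sum, Fintype.card_fin] using this
    refine ⟨h, (blockEquiv h).symm.trans (((Fintype.equivFin _).symm.sumCongr
      (Fintype.equivFin _).symm).trans (Equiv.sumCompl fun i => 0 < s i)), fun i => ?_⟩
    obtain ⟨a, rfl⟩ := (blockEquiv h).surjective i
    rcases a with a | a
    · simp only [Equiv.trans_apply, Equiv.symm_apply_apply, signVec, Equiv.sumCongr_apply,
        Sum.map_inl, Equiv.sumCompl_apply_inl, Sum.elim_inl, one_mul]
      rw [abs_of_pos (Subtype.prop ((Fintype.equivFin {i // 0 < s i}).symm a))]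
    · simp only [Equiv.trans_apply, Equiv.symm_apply_apply, signVec, Equiv.sumCongr_apply,
        Sum.map_inr, Equiv.sumCompl_apply_inr, Sum.elim_inr]
      rw [abs_of_nonpos (not_lt.mp (Subtype.prop ((Fintype.equivFin {i // ¬ 0 < s i}).symm a)))]
      ring
  -- The sign `ε` is -1 exactly when the negative terms are the majority; it is what allows q ≤ p.
  by_cases hc : Fintype.card {i // ¬ 0 < s i} ≤ Fintype.card {i // 0 < s i}
  · obtain ⟨h, e, he⟩ := main s hs
    exact ⟨_, _, h, e, 1, hc, Or.inl rfl, fun i => by rw [one_mul]; exact he i⟩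
  · obtain ⟨h, e, he⟩ := main (-s) (fun i => neg_ne_zero.mpr (hs i))
    refine ⟨_, _, h, e, -1, ?_, Or.inr rfl, fun i => ?_⟩
    · have h1 : Fintype.card {i // ¬ 0 < (-s) i} = Fintype.card {i // 0 < s i} :=
        Fintype.card_congr (Equiv.subtypeEquivRight fun i => by
          simp [le_iff_lt_or_eq, (hs i).symm])
      have h2 : Fintype.card {i // 0 < (-s) i} = Fintype.card {i // ¬ 0 < s i} :=
        Fintype.card_congr (Equiv.subtypeEquivRight fun i => by
          simp [le_iff_lt_or_eq, hs i])
      omega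
    · have := he i
      simp only [Pi.neg_apply, abs_neg] at this
      rw [neg_one_mul]; exact this

/-- **Sylvester's law of inertia** (existence), up to sign. -/
theorem exists_signature_congr {𝕜 : Type*} [RCLike 𝕜] (H : Matrix (Fin n) (Fin n) 𝕜)
    (hH : H.IsHermitian) (hu : IsUnit H.det) :
    ∃ (p q : ℕ) (h : p + q = n) (C : GL (Fin n) 𝕜) (ε : ℝ), q ≤ p ∧ (ε = 1 ∨ ε = -1) ∧
      C.valᴴ * (diagonal fun i => ((signVec h i : ℝ) : 𝕜)) * C.val = (ε : 𝕜) • H := by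
  have hs : ∀ i, hH.eigenvalues i ≠ 0 := by
    intro i hi
    rw [hH.det_eq_prod_eigenvalues] at hu
    exact hu.ne_zero (Finset.prod_eq_zero (Finset.mem_univ i) (by simp [hi]))
  obtain ⟨p, q, h, e, ε, hqp, hε, he⟩ := exists_signature _ hs
  let U : Matrix (Fin n) (Fin n) 𝕜 := (hH.eigenvectorUnitary : Matrix (Fin n) (Fin n) 𝕜)
  have hU : U * Uᴴ = 1 := Unitary.coe_mul_star_self hH.eigenvectorUnitary
  have hHU : H = U * diagonal (fun i => ((hH.eigenvalues i : ℝ) : 𝕜)) * Uᴴ := by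
    have := hH.spectral_theorem
    rw [Unitary.conjStarAlgAut_apply] at this
    exact this
  let V := U.submatrix id e
  have hV : V * Vᴴ = 1 := by
    rw [conjTranspose_submatrix, submatrix_mul_equiv, hU, submatrix_id_id]
  have hHV : H = V * diagonal (fun i => ((hH.eigenvalues (e i) : ℝ) : 𝕜)) * Vᴴ := by
    conv_lhs => rw [hHU]
    ext i j
    rw [Matrix.mul_apply, Matrix.mul_apply]
    simp only [V, mul_diagonal, submatrix_apply, id, conjTranspose_apply]
    exact (e.sum_comp fun k => U i k * ((hH.eigenvalues k : ℝ) : 𝕜) * star (U j k)).symm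
  -- Scaling the sorted eigenvectors by the square roots of the absolute values of the eigenvalues
  -- leaves only their signs.
  let r : Fin n → ℝ := fun i => √|hH.eigenvalues (e i)|
  have hr : ∀ i, r i ≠ 0 := fun i => (Real.sqrt_pos.mpr (abs_pos.mpr (hs _))).ne'
  let R : Matrix (Fin n) (Fin n) 𝕜 := diagonal fun i => ((r i : ℝ) : 𝕜)
  let R' : Matrix (Fin n) (Fin n) 𝕜 := diagonal fun i => (((r i)⁻¹ : ℝ) : 𝕜)
  have hRR' : R * R' = 1 := by
    simp only [R, R', diagonal_mul_diagonal, ← RCLike.ofReal_mul, mul_inv_cancel₀ (hr _)]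
    simp
  have hC : (R * Vᴴ) * (V * R') = 1 := by
    rw [Matrix.mul_assoc, ← Matrix.mul_assoc Vᴴ, mul_eq_one_comm.mp hV, Matrix.one_mul, hRR']
  refine ⟨p, q, h, ⟨R * Vᴴ, V * R', hC, mul_eq_one_comm.mp hC⟩, ε, hqp, hε, ?_⟩
  change (R * Vᴴ)ᴴ * _ * (R * Vᴴ) = _
  have hR : Rᴴ = R := by
    simp [R, diagonal_conjTranspose, Pi.star_def]
  rw [conjTranspose_mul, conjTranspose_conjTranspose, hR]
  have : R * (diagonal fun i => ((signVec h i : ℝ) : 𝕜)) * R =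
      (ε : 𝕜) • diagonal (fun i => ((hH.eigenvalues (e i) : ℝ) : 𝕜)) := by
    rw [← diagonal_smul]
    simp only [R, diagonal_mul_diagonal]
    congr 1
    ext i
    simp only [Pi.smul_apply, smul_eq_mul, ← RCLike.ofReal_mul]
    congr 1
    rw [he i]
    have : r i * r i = |hH.eigenvalues (e i)| := Real.mul_self_sqrt (abs_nonneg _)
    rw [← this]; ring
  calc _ = V * (R * (diagonal fun i => ((signVec h i : ℝ) : 𝕜)) * R) * Vᴴ := by
        simp only [Matrix.mul_assoc]
    _ = _ := by rw [this, Matrix.mul_smul, Matrix.smul_mul, ← hHV]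

/-! ### Hilbert's theorem 90 -/

/-- With c = 1 + ri, r real, the matrix is (1 + Y) + r·i(1 - Y). Its determinant is a polynomial in
r, nonzero because its value at r = -i is det(2·1), so it does not vanish at some real r. -/
theorem exists_isUnit_add (Y : Matrix (Fin n) (Fin n) ℂ) :
    ∃ c : ℂ, IsUnit (c • (1 : Matrix (Fin n) (Fin n) ℂ) + starRingEnd ℂ c • Y) := by
  let M : Matrix (Fin n) (Fin n) (Polynomial ℂ) :=
    (1 + Y).map Polynomial.C + (Polynomial.X : Polynomial ℂ) • (Complex.I • (1 - Y)).map Polynomial.C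
  have hM : ∀ z : ℂ, (M.det).eval z = ((1 + Y) + z • (Complex.I • (1 - Y))).det := by
    intro z
    have := RingHom.map_det (Polynomial.evalRingHom z) M
    rw [Polynomial.coe_evalRingHom] at this
    rw [this]
    congr 1
    ext i j
    simp [M]
  have hne : M.det ≠ 0 := by
    intro h0
    have := hM (-Complex.I)
    rw [h0, Polynomial.eval_zero, smul_smul] at this
    have h2 : (1 : Matrix (Fin n) (Fin n) ℂ) + Y + (-Complex.I * Complex.I) • (1 - Y) =
        (2 : ℂ) • 1 := by
      simp [two_smul]
    rw [h2, det_smul, det_one, mul_one] at this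
    exact pow_ne_zero _ two_ne_zero this.symm
  have : ∃ r : ℝ, (M.det).eval (r : ℂ) ≠ 0 := by
    by_contra! hcon
    apply hne
    apply Polynomial.eq_zero_of_infinite_isRoot
    refine Set.Infinite.mono ?_ (Set.infinite_range_of_injective Complex.ofReal_injective)
    rintro _ ⟨r, rfl⟩
    exact hcon r
  obtain ⟨r, hr⟩ := this
  refine ⟨1 + r * Complex.I, ?_⟩
  rw [Matrix.isUnit_iff_isUnit_det, isUnit_iff_ne_zero]
  rw [hM] at hr
  convert hr using 2
  ext i j
  simp
  ring

/-- A twisted form of **Hilbert's theorem 90**. -/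
theorem exists_twisted_coboundary (A X : GL (Fin n) ℂ)
    (h : A * conjHom n A * conjHom n X * X = 1) :
    ∃ S : GL (Fin n) ℂ, A * conjHom n S * X = S := by
  -- The twisted average S = c + c̄AX satisfies AS̄X = c̄AX + c(AĀX̄X) = S for every c; the choice
  -- of c only makes it invertible.
  obtain ⟨c, hc⟩ := exists_isUnit_add (A.val * X.val)
  obtain ⟨S, hS⟩ := hc
  refine ⟨S, Units.ext ?_⟩
  have h' : A.val * (mbar A.val * (mbar X.val * X.val)) = 1 := by
    have := congrArg Units.val h
    simpa [Matrix.mul_assoc] using this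
  simp only [Units.val_mul, conjHom_val, hS, mbar_add, mbar_smul, mbar_one, mbar_mul,
    Complex.conj_conj, Matrix.mul_add, Matrix.add_mul, Matrix.mul_smul, Matrix.smul_mul,
    Matrix.mul_one, Matrix.mul_assoc, h']
  exact add_comm _ _


end

section

/-! ### Diagonalization compatible with an antiunitary map -/

section Paired

variable {E : Type*} [NormedAddCommGroup E] [InnerProductSpace ℂ E] [FiniteDimensional ℂ E]

open Module

/-- A symmetric operator that preserves a proper subspace has an eigenvector orthogonal to this
subspace. -/
theorem exists_eigenvector_mem_orthogonal {T : E →ₗ[ℂ] E} (hT : T.IsSymmetric)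
    (W : Submodule ℂ E) (hW : ∀ w ∈ W, T w ∈ W) (hne : W ≠ ⊤) :
    ∃ (μ : ℝ) (x : E), x ∈ Wᗮ ∧ x ≠ 0 ∧ T x = (μ : ℂ) • x := by
  have hW' : ∀ x ∈ Wᗮ, T x ∈ Wᗮ := by
    intro x hx
    rw [Submodule.mem_orthogonal] at hx ⊢
    intro w hw
    rw [← hT]
    exact hx _ (hW w hw)
  have : Nontrivial Wᗮ := by
    rw [Submodule.nontrivial_iff_ne_bot]
    intro h
    exact hne (by rwa [Submodule.orthogonal_eq_bot_iff] at h)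
  obtain ⟨μ, hμ⟩ := Module.End.exists_eigenvalue (T.restrict hW')
  obtain ⟨x, hx⟩ := hμ.exists_hasEigenvector
  have hx1 : T x.1 = μ • x.1 := congrArg Subtype.val hx.apply_eq_smul
  have hx0 : x.1 ≠ 0 := fun h => hx.2 (Subtype.ext h)
  have hre : starRingEnd ℂ μ = μ := hT.conj_eigenvalue_eq_self
    (Module.End.hasEigenvalue_of_hasEigenvector ⟨Module.End.mem_eigenspace_iff.mpr hx1, hx0⟩)
  refine ⟨μ.re, x.1, x.2, hx0, ?_⟩
  rw [Complex.conj_eq_iff_re.mp hre, hx1]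

/-- A symmetric operator `T` that sends the eigenvectors for `μ` to eigenvectors for `τ μ` by an
antiunitary map `j` has an orthonormal eigenbasis made of vectors `v` and `j v`. -/
theorem exists_paired_eigenbasis {T : E →ₗ[ℂ] E} (hT : T.IsSymmetric) (j : E → E) (c : ℂ)
    (hc : c ≠ 0) (hj : ∀ x y, inner ℂ (j x) (j y) = inner ℂ y x) (hjj : ∀ x, j (j x) = c • x)
    (τ : ℝ → ℝ) (hτ : ∀ (μ : ℝ) (x : E), T x = (μ : ℂ) • x → x ≠ 0 → T (j x) = (τ μ : ℂ) • j x)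
    (horth : ∀ (μ : ℝ) (x : E), T x = (μ : ℂ) • x → inner ℂ x (j x) = 0)
    (good : ℝ → Prop)
    (hgood : ∀ (μ : ℝ) (x : E), T x = (μ : ℂ) • x → x ≠ 0 → good μ ∨ good (τ μ)) :
    ∃ (k : ℕ) (b : OrthonormalBasis (Fin k ⊕ Fin k) ℂ E) (d : Fin k → ℝ),
      (∀ i, b (Sum.inr i) = j (b (Sum.inl i))) ∧
      (∀ i, T (b (Sum.inl i)) = (d i : ℂ) • b (Sum.inl i)) ∧ ∀ i, good (d i) := by
  classical
  have hnorm : ∀ x, ‖j x‖ = ‖x‖ := by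
    intro x
    have h := hj x x
    rw [inner_self_eq_norm_sq_to_K, inner_self_eq_norm_sq_to_K] at h
    have h' : ‖j x‖ ^ 2 = ‖x‖ ^ 2 := by exact_mod_cast h
    exact (sq_eq_sq₀ (norm_nonneg _) (norm_nonneg _)).mp h'
  have hne : ∀ x, x ≠ 0 → j x ≠ 0 := by
    intro x hx h
    rw [← norm_eq_zero, hnorm, norm_eq_zero] at h
    exact hx h
  have elim_orthonormal : ∀ (k : ℕ) (v : Fin k → E), Orthonormal ℂ v →
      (∀ i l, inner ℂ (v i) (j (v l)) = 0) → Orthonormal ℂ (Sum.elim v (j ∘ v)) := by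
    intro k v hv hvj
    rw [orthonormal_iff_ite] at hv ⊢
    rintro (i | i) (l | l)
    · simpa using hv i l
    · simpa using hvj i l
    · simpa using inner_eq_zero_symm.mp (hvj l i)
    · have := hv l i
      simp only [Sum.elim_inr, Function.comp_apply, hj, Sum.inr.injEq]
      rw [this]
      simp [eq_comm]
  -- If there is no such basis, the pairs found so far never span E, so another pair can always be
  -- added in the orthogonal of their span. Orthonormal families of every size would then exist,
  -- against finite dimension.
  by_contra hcon
  have main : ∀ k : ℕ, ∃ (v : Fin k → E) (d : Fin k → ℝ), Orthonormal ℂ v ∧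
      (∀ i l, inner ℂ (v i) (j (v l)) = 0) ∧ (∀ i, T (v i) = (d i : ℂ) • v i) ∧
      ∀ i, good (d i) := by
    intro k
    induction k with
    | zero =>
      exact ⟨Fin.elim0, Fin.elim0, ⟨fun i => i.elim0, fun i => i.elim0⟩, fun i => i.elim0,
        fun i => i.elim0, fun i => i.elim0⟩
    | succ k ih =>
      obtain ⟨v, d, hv, hvj, hTv, hd⟩ := ih
      have hon := elim_orthonormal k v hv hvj
      have hvne : ∀ i, v i ≠ 0 := fun i => hv.ne_zero i
      let W := Submodule.span ℂ (Set.range (Sum.elim v (j ∘ v)))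
      have hvW : ∀ i, v i ∈ W := fun i => Submodule.subset_span ⟨Sum.inl i, rfl⟩
      have hjW : ∀ i, j (v i) ∈ W := fun i => Submodule.subset_span ⟨Sum.inr i, rfl⟩
      have hWT : ∀ w ∈ W, T w ∈ W := by
        intro w hw
        induction hw using Submodule.span_induction with
        | mem x hx =>
          obtain ⟨i | i, rfl⟩ := hx
          · simp only [Sum.elim_inl, hTv i]
            exact W.smul_mem _ (hvW i)
          · simp only [Sum.elim_inr, Function.comp_apply, hτ _ _ (hTv i) (hvne i)]
            exact W.smul_mem _ (hjW i)
        | zero => simp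
        | add x y _ _ hx hy => rw [map_add]; exact W.add_mem hx hy
        | smul a x _ hx => rw [map_smul]; exact W.smul_mem _ hx
      have hW : W ≠ ⊤ := by
        intro h
        apply hcon
        refine ⟨k, OrthonormalBasis.mk hon h.ge, d, ?_, ?_, hd⟩ <;> intro i <;> simp [hTv]
      have horthW : ∀ x, (∀ i, inner ℂ (v i) x = 0) → (∀ i, inner ℂ (j (v i)) x = 0) →
          x ∈ Wᗮ := by
        intro x h1 h2
        rw [Submodule.mem_orthogonal]
        intro w hw
        induction hw using Submodule.span_induction with
        | mem y hy =>
          obtain ⟨i | i, rfl⟩ := hy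
          · exact h1 i
          · exact h2 i
        | zero => simp
        | add y z _ _ hy hz => rw [inner_add_left, hy, hz, add_zero]
        | smul a y _ hy => rw [inner_smul_left, hy, mul_zero]
      -- As j² = c ≠ 0, the subspace W is stable by j up to scalars on its generators, and the
      -- antiunitarity of j carries orthogonality over.
      have hjWW : ∀ x ∈ Wᗮ, j x ∈ Wᗮ := by
        intro x hx
        rw [Submodule.mem_orthogonal] at hx
        refine horthW _ (fun i => ?_) (fun i => ?_)
        · have h1 : inner ℂ (j (j (v i))) (j x) = 0 := by
            rw [hj]; exact inner_eq_zero_symm.mp (hx _ (hjW i))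
          rw [hjj, inner_smul_left] at h1
          exact (mul_eq_zero.mp h1).resolve_left (by simpa using hc)
        · rw [hj]; exact inner_eq_zero_symm.mp (hx _ (hvW i))
      obtain ⟨μ, x, hx, hx0, hTx⟩ := exists_eigenvector_mem_orthogonal hT W hWT hW
      -- Both `x` and `j x` are eigenvectors orthogonal to W, with eigenvalues `μ` and `τ μ`; the
      -- one with a good eigenvalue starts the new pair.
      obtain ⟨ν, y, hy, hy0, hTy, hν⟩ :
          ∃ (ν : ℝ) (y : E), y ∈ Wᗮ ∧ y ≠ 0 ∧ T y = (ν : ℂ) • y ∧ good ν := by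
        rcases hgood μ x hTx hx0 with h | h
        · exact ⟨μ, x, hx, hx0, hTx, h⟩
        · exact ⟨τ μ, j x, hjWW x hx, hne x hx0, hτ μ x hTx hx0, h⟩
      obtain ⟨z, hz, hz1, hTz⟩ : ∃ z ∈ Wᗮ, ‖z‖ = 1 ∧ T z = (ν : ℂ) • z := by
        refine ⟨((‖y‖⁻¹ : ℝ) : ℂ) • y, Wᗮ.smul_mem _ hy, ?_, ?_⟩
        · rw [norm_smul, Complex.norm_real, norm_inv, norm_norm,
            inv_mul_cancel₀ (norm_ne_zero_iff.mpr hy0)]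
        · rw [map_smul, hTy, smul_comm]
      have hjz := hjWW z hz
      rw [Submodule.mem_orthogonal] at hz hjz
      refine ⟨Fin.cons z v, Fin.cons ν d, ?_, ?_, ?_, ?_⟩
      · rw [orthonormal_iff_ite] at hv ⊢
        intro i l
        refine Fin.cases ?_ (fun i => ?_) i <;> refine Fin.cases ?_ (fun l => ?_) l
        · simp [inner_self_eq_norm_sq_to_K, hz1]
        · simpa [(Fin.succ_ne_zero l).symm] using inner_eq_zero_symm.mp (hz _ (hvW l))
        · simpa [Fin.succ_ne_zero] using hz _ (hvW i)
        · simpa using hv i l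
      · intro i l
        refine Fin.cases ?_ (fun i => ?_) i <;> refine Fin.cases ?_ (fun l => ?_) l
        · simpa using horth ν z hTz
        · simpa using inner_eq_zero_symm.mp (hz _ (hjW l))
        · simpa using hjz _ (hvW i)
        · simpa using hvj i l
      · intro i
        refine Fin.cases ?_ (fun i => ?_) i
        · simpa using hTz
        · simpa using hTv i
      · intro i
        refine Fin.cases ?_ (fun i => ?_) i
        · simpa using hν
        · simpa using hd i
  obtain ⟨v, d, hv, -⟩ := main (finrank ℂ E + 1)
  have := hv.linearIndependent.fintype_card_le_finrank
  simp at this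

end Paired

variable {n : ℕ}

/-- The matrix `[[0, c], [1, 0]]`. -/
def pairBlock (k : ℕ) (c : ℂ) : Matrix (Fin k ⊕ Fin k) (Fin k ⊕ Fin k) ℂ :=
  fromBlocks 0 (c • 1) 1 0

theorem star_mulVec_dotProduct_mulVec (J : Matrix (Fin n) (Fin n) ℂ) (hJ : Jᴴ * J = 1)
    (x y : Fin n → ℂ) : star (J *ᵥ x) ⬝ᵥ (J *ᵥ y) = star x ⬝ᵥ y := by
  rw [star_mulVec, ← dotProduct_mulVec, mulVec_mulVec, hJ, one_mulVec]

/-- The matrix version of `exists_paired_eigenbasis`, for the antiunitary map `v ↦ J v̄`. -/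
theorem exists_paired_diagonalization (H : Matrix (Fin n) (Fin n) ℂ) (hH : H.IsHermitian)
    (J : Matrix (Fin n) (Fin n) ℂ) (c : ℂ) (hc : c ≠ 0) (hJ : Jᴴ * J = 1)
    (hJJ : J * mbar J = c • 1) (τ : ℝ → ℝ)
    (hτ : ∀ (μ : ℝ) (x : Fin n → ℂ), H *ᵥ x = (μ : ℂ) • x → x ≠ 0 →
      H *ᵥ (J *ᵥ star x) = (τ μ : ℂ) • (J *ᵥ star x))
    (horth : ∀ (μ : ℝ) (x : Fin n → ℂ), H *ᵥ x = (μ : ℂ) • x → star x ⬝ᵥ (J *ᵥ star x) = 0)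
    (good : ℝ → Prop)
    (hgood : ∀ (μ : ℝ) (x : Fin n → ℂ), H *ᵥ x = (μ : ℂ) • x → x ≠ 0 → good μ ∨ good (τ μ)) :
    ∃ (k : ℕ) (_ : k + k = n) (V : Matrix (Fin n) (Fin k ⊕ Fin k) ℂ) (d : Fin k → ℝ),
      V * Vᴴ = 1 ∧ Vᴴ * V = 1 ∧
      H * V = V * diagonal (fun i => ((Sum.elim d (τ ∘ d) i : ℝ) : ℂ)) ∧
      J * mbar V = V * pairBlock k c ∧
      (∀ i, good (d i)) ∧ ∀ i, ∃ x : Fin n → ℂ, x ≠ 0 ∧ H *ᵥ x = (d i : ℂ) • x := by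
  let T := Matrix.toEuclideanLin H
  have hT : T.IsSymmetric := Matrix.isSymmetric_toEuclideanLin_iff.mpr hH
  let j : EuclideanSpace ℂ (Fin n) → EuclideanSpace ℂ (Fin n) :=
    fun x => WithLp.toLp 2 (J *ᵥ star x.ofLp)
  have hTx : ∀ (a : ℂ) (x : EuclideanSpace ℂ (Fin n)),
      T x = a • x ↔ H *ᵥ x.ofLp = a • x.ofLp := by
    intro a x
    rw [← (WithLp.ofLp_injective 2).eq_iff]
    rfl
  have hx0 : ∀ x : EuclideanSpace ℂ (Fin n), x ≠ 0 ↔ x.ofLp ≠ 0 := by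
    intro x
    rw [not_iff_not, ← (WithLp.ofLp_injective 2).eq_iff]
    rfl
  have hinner : ∀ x y : EuclideanSpace ℂ (Fin n), inner ℂ x y = star x.ofLp ⬝ᵥ y.ofLp := by
    intro x y
    rw [EuclideanSpace.inner_eq_star_dotProduct, dotProduct_comm]
  have hjjv : ∀ x : Fin n → ℂ, J *ᵥ star (J *ᵥ star x) = c • x := by
    intro x
    rw [← mbar_mulVec_star, star_star, mulVec_mulVec, hJJ, smul_mulVec, one_mulVec]
  obtain ⟨k, b, d, hb, hd, hg⟩ := exists_paired_eigenbasis hT j c hc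
    (fun x y => by
      rw [hinner, hinner]
      simp only [j]
      rw [star_mulVec_dotProduct_mulVec J hJ, star_star, dotProduct_comm])
    (fun x => WithLp.ofLp_injective 2 (hjjv x.ofLp))
    τ (fun μ x h h0 => by
      rw [hTx] at h ⊢
      exact hτ μ x.ofLp h ((hx0 x).mp h0))
    (fun μ x h => by
      rw [hTx] at h
      rw [hinner]
      exact horth μ _ h)
    good (fun μ x h h0 => by
      rw [hTx] at h
      exact hgood μ _ h ((hx0 x).mp h0))
  have hkn : k + k = n := by
    have := Module.finrank_eq_card_basis b.toBasis
    simpa using this.symm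
  let V : Matrix (Fin n) (Fin k ⊕ Fin k) ℂ := Matrix.of fun i a => (b a).ofLp i
  have hVV : Vᴴ * V = 1 := by
    ext a a'
    have := (orthonormal_iff_ite.mp b.orthonormal) a a'
    rw [hinner] at this
    rw [Matrix.one_apply, ← this]
    rfl
  have hVV' : V * Vᴴ = 1 := by
    exact (Matrix.mul_eq_one_comm_of_card_eq _ _ _ (by simp [hkn])).mp hVV
  have hne : ∀ a, (b a).ofLp ≠ 0 := fun a => (hx0 _).mp (b.orthonormal.ne_zero a)
  have hHb : ∀ i, H *ᵥ (b (Sum.inl i)).ofLp = (d i : ℂ) • (b (Sum.inl i)).ofLp :=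
    fun i => (hTx _ _).mp (hd i)
  have hbr : ∀ i, (b (Sum.inr i)).ofLp = J *ᵥ star (b (Sum.inl i)).ofLp := fun i => by
    rw [hb i]
  refine ⟨k, hkn, V, d, hVV', hVV, ?_, ?_, hg, fun i => ⟨_, hne _, hHb i⟩⟩
  · ext i a
    rw [mul_diagonal]
    rcases a with a | a
    · have := congrFun (hHb a) i
      rw [Pi.smul_apply, smul_eq_mul, mul_comm] at this
      exact this
    · have := congrFun (hτ _ _ (hHb a) (hne _)) i
      rw [← hbr, Pi.smul_apply, smul_eq_mul, mul_comm] at this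
      exact this
  -- The antiunitary map sends v to the second vector of its pair, and that vector to J J̄ v = c v;
  -- `pairBlock k c` records this.
  · ext i a
    have hl : (J * mbar V) i a = (J *ᵥ star (b a).ofLp) i := rfl
    rw [hl, Matrix.mul_apply, Fintype.sum_sum_type]
    rcases a with a | a
    · rw [← hbr]
      simp [pairBlock, Matrix.one_apply, V]
    · rw [hbr, hjjv]
      simp [pairBlock, Matrix.one_apply, V, mul_comm]


end

section

/-! ### Normal forms -/

section PairBlock

variable (k : ℕ)

theorem pairBlock_mul_diagonal (c : ℂ) (a b : Fin k → ℂ) :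
    pairBlock k c * diagonal (Sum.elim a b) = diagonal (Sum.elim b a) * pairBlock k c := by
  ext i l
  rw [mul_diagonal, diagonal_mul]
  rcases i with i | i <;> rcases l with l | l <;> simp [pairBlock, Matrix.one_apply] <;>
    split_ifs with h <;> simp [h, mul_comm]

theorem pairBlock_mul_self (c : ℂ) : pairBlock k c * pairBlock k c = c • 1 := by
  rw [pairBlock, fromBlocks_multiply, ← fromBlocks_one, fromBlocks_smul]
  simp

theorem pairBlock_one_conjTranspose : (pairBlock k 1)ᴴ = pairBlock k 1 := by
  simp [pairBlock, fromBlocks_conjTranspose]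

/-- The matrix `[[-i, 0], [0, i]]`. -/
def altDiag : Matrix (Fin k ⊕ Fin k) (Fin k ⊕ Fin k) ℂ :=
  diagonal (Sum.elim (fun _ => -Complex.I) (fun _ => Complex.I))

end PairBlock

/-- The diagonal matrix with real diagonal blocks `a` and `b`. -/
def realDiag {k : ℕ} (a b : Fin k → ℝ) : Matrix (Fin k ⊕ Fin k) (Fin k ⊕ Fin k) ℂ :=
  diagonal (Sum.elim (fun i => (a i : ℂ)) (fun i => (b i : ℂ)))

section RealDiag

variable {k : ℕ} (a b a' b' : Fin k → ℝ)

theorem realDiag_mul : realDiag a b * realDiag a' b' = realDiag (a * a') (b * b') := by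
  rw [realDiag, realDiag, diagonal_mul_diagonal, realDiag]
  congr 1
  ext i
  rcases i with i | i <;> simp

theorem realDiag_one : realDiag (1 : Fin k → ℝ) 1 = 1 := by
  rw [realDiag, ← diagonal_one]
  congr 1
  ext i
  rcases i with i | i <;> simp

theorem realDiag_conjTranspose : (realDiag a b)ᴴ = realDiag a b := by
  rw [realDiag, diagonal_conjTranspose]
  congr 1
  ext i
  rcases i with i | i <;> simp

theorem realDiag_transpose : (realDiag a b)ᵀ = realDiag a b := diagonal_transpose _

theorem mbar_realDiag : mbar (realDiag a b) = realDiag a b := by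
  rw [← transpose_transpose (mbar (realDiag a b)), mbar_transpose, realDiag_conjTranspose,
    realDiag_transpose]

theorem pairBlock_mul_realDiag (c : ℂ) :
    pairBlock k c * realDiag a b = realDiag b a * pairBlock k c := pairBlock_mul_diagonal k c _ _

/-- Crossing `pairBlock` exchanges the two diagonal blocks, so inverse blocks cancel. Hence diag(r,
r⁻¹) can rescale eigenvalues without altering the bilinear form that `pairBlock` represents. -/
theorem pairBlock_mul_realDiag_sq (hab : a * b = 1) (c : ℂ) :
    pairBlock k c * realDiag a b * (pairBlock k c * realDiag a b) = c • 1 := by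
  calc pairBlock k c * realDiag a b * (pairBlock k c * realDiag a b)
      = pairBlock k c * (realDiag a b * realDiag b a) * pairBlock k c := by
        rw [pairBlock_mul_realDiag a b]
        simp only [← Matrix.mul_assoc]
        rw [← pairBlock_mul_realDiag a b]
    _ = c • 1 := by
        rw [realDiag_mul, mul_comm b a, hab, realDiag_one, Matrix.mul_one, pairBlock_mul_self]

theorem altDiag_mul_realDiag : altDiag k * realDiag a b = realDiag a b * altDiag k := by
  rw [altDiag, realDiag, diagonal_mul_diagonal, diagonal_mul_diagonal]
  simp only [mul_comm]

theorem diagonal_ofReal_elim :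
    (diagonal fun i => ((Sum.elim a b i : ℝ) : ℂ)) = realDiag a b := by
  rw [realDiag]
  congr 1
  ext i
  rcases i with i | i <;> simp

theorem neg_I_smul_realDiag_neg : (-Complex.I) • realDiag a (-b) = altDiag k * realDiag a b := by
  rw [altDiag, realDiag, realDiag, diagonal_mul_diagonal, ← diagonal_smul]
  congr 1
  ext i
  rcases i with i | i <;> simp

end RealDiag

variable {n : ℕ}

theorem dotProduct_eq_zero_of_eigenvector_ne {H : Matrix (Fin n) (Fin n) ℂ} (hH : H.IsHermitian)
    {μ ν : ℝ} (hμν : μ ≠ ν) {x y : Fin n → ℂ} (hx : H *ᵥ x = (μ : ℂ) • x)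
    (hy : H *ᵥ y = (ν : ℂ) • y) : star x ⬝ᵥ y = 0 := by
  have h1 : star (H *ᵥ x) ⬝ᵥ y = star x ⬝ᵥ (H *ᵥ y) := by
    rw [star_mulVec, ← dotProduct_mulVec, hH.eq]
  rw [hx, hy, star_smul, smul_dotProduct, dotProduct_smul] at h1
  have h2 : ((μ : ℂ) - ν) * (star x ⬝ᵥ y) = 0 := by
    rw [sub_mul, sub_eq_zero]
    simpa using h1
  refine (mul_eq_zero.mp h2).resolve_left ?_
  exact sub_ne_zero.mpr (by exact_mod_cast hμν)

theorem eigenvalue_ne_zero {H H' : Matrix (Fin n) (Fin n) ℂ} (hH : H' * H = 1) {μ : ℝ}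
    {x : Fin n → ℂ} (hx : H *ᵥ x = (μ : ℂ) • x) (hx0 : x ≠ 0) : μ ≠ 0 := by
  rintro rfl
  apply hx0
  have := congrArg (fun y => H' *ᵥ y) hx
  simpa [mulVec_mulVec, hH] using this

theorem eq_mul_mul_conjTranspose {l : Type*} [Fintype l] [DecidableEq l]
    {H : Matrix (Fin n) (Fin n) ℂ} {V : Matrix (Fin n) l ℂ} {D : Matrix l l ℂ} (hV : V * Vᴴ = 1)
    (h : H * V = V * D) : H = V * D * Vᴴ := by
  rw [← h, Matrix.mul_assoc, hV, Matrix.mul_one]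

/-- A real alternating invertible matrix in the basis of conjugate eigenvectors. -/
theorem exists_alternating_factor (B : Matrix (Fin n) (Fin n) ℂ) (hBT : Bᵀ = -B)
    (hB : mbar B = B) (B' : Matrix (Fin n) (Fin n) ℂ) (hBB' : B' * B = 1) :
    ∃ (k : ℕ) (_ : k + k = n) (A : Matrix (Fin k ⊕ Fin k) (Fin n) ℂ)
      (A' : Matrix (Fin n) (Fin k ⊕ Fin k) ℂ), A * A' = 1 ∧ A' * A = 1 ∧
      mbar A = pairBlock k 1 * A ∧ Aᴴ * altDiag k * A = B := by
  -- Since B is real and alternating, iB is Hermitian and conjugation exchanges its eigenvalues μ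
  -- and -μ. The pairs are (v, v̄) with μ > 0.
  have hH : (Complex.I • B).IsHermitian := by
    rw [IsHermitian, conjTranspose_smul, ← mbar_transpose, hB, hBT]
    simp
  have hinv : ((-Complex.I) • B') * (Complex.I • B) = 1 := by
    simp [smul_smul, hBB']
  have hτ : ∀ (μ : ℝ) (x : Fin n → ℂ), (Complex.I • B) *ᵥ x = (μ : ℂ) • x →
      (Complex.I • B) *ᵥ star x = ((-μ : ℝ) : ℂ) • star x := by
    intro μ x hx
    have h1 := congrArg star hx
    rw [← mbar_mulVec_star, mbar_smul, hB] at h1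
    rw [Complex.conj_I, neg_smul, neg_mulVec] at h1
    rw [neg_eq_iff_eq_neg.mp h1]
    simp
  obtain ⟨k, hk, V, d, hV, hV', hHV, hbar, hd, -⟩ := exists_paired_diagonalization
    (Complex.I • B) hH 1 1 one_ne_zero (by simp) (by simp) (fun μ => -μ)
    (fun μ x hx _ => by rw [one_mulVec]; exact hτ μ x hx)
    (fun μ x hx => by
      rw [one_mulVec]
      by_cases hx0 : x = 0
      · simp [hx0]
      · have h0 := eigenvalue_ne_zero hinv hx hx0
        exact dotProduct_eq_zero_of_eigenvector_ne hH
          (fun h => h0 (by linarith)) hx (hτ μ x hx))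
    (fun μ => 0 < μ)
    (fun μ x hx hx0 => by
      rcases (eigenvalue_ne_zero hinv hx hx0).lt_or_gt with h | h
      · right; linarith
      · left; exact h)
  rw [Matrix.one_mul] at hbar
  rw [diagonal_ofReal_elim] at hHV
  have hBV := eq_mul_mul_conjTranspose hV hHV
  -- Scaling both vectors of a pair by the same square root absorbs the eigenvalue and leaves the
  -- constant matrix `altDiag k`.
  let r : Fin k → ℝ := fun i => √(d i)
  have hr : r * r = d := funext fun i => Real.mul_self_sqrt (hd i).le
  have hr' : r * r⁻¹ = 1 := funext fun i => mul_inv_cancel₀ (Real.sqrt_pos.mpr (hd i)).ne'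
  have hA : realDiag r r * Vᴴ * (V * realDiag r⁻¹ r⁻¹) = 1 := by
    rw [Matrix.mul_assoc, ← Matrix.mul_assoc Vᴴ, hV', Matrix.one_mul, realDiag_mul, hr',
      realDiag_one]
  refine ⟨k, hk, realDiag r r * Vᴴ, V * realDiag r⁻¹ r⁻¹, hA,
    (Matrix.mul_eq_one_comm_of_card_eq _ _ _ (by simp [hk])).mp hA, ?_, ?_⟩
  · rw [mbar_mul, mbar_realDiag, mbar_conjTranspose, ← conjTranspose_mbar, hbar, conjTranspose_mul,
      pairBlock_one_conjTranspose, ← Matrix.mul_assoc, ← Matrix.mul_assoc, pairBlock_mul_realDiag]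
  · rw [conjTranspose_mul, conjTranspose_conjTranspose, realDiag_conjTranspose]
    calc V * realDiag r r * altDiag k * (realDiag r r * Vᴴ)
        = V * (realDiag r r * altDiag k * realDiag r r) * Vᴴ := by simp only [Matrix.mul_assoc]
      _ = V * ((-Complex.I) • realDiag d (-d)) * Vᴴ := by
        rw [← altDiag_mul_realDiag, Matrix.mul_assoc (altDiag k), realDiag_mul, hr, neg_I_smul_realDiag_neg]
      _ = (-Complex.I) • (V * realDiag d ((fun μ => -μ) ∘ d) * Vᴴ) := by
        rw [Matrix.mul_smul, Matrix.smul_mul]; rfl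
      _ = B := by rw [← hBV]; simp [smul_smul]

/-- Real alternating invertible matrices are congruent over `ℝ` to `J_{2m}`. -/
theorem exists_real_congr_matJ {m : ℕ} (h : m + m = n) (B : GL (Fin n) ℂ) (hBT : B.valᵀ = -B.val)
    (hB : mbar B.val = B.val) :
    ∃ C : GL (Fin n) ℂ, conjHom n C = C ∧ C.valᵀ * matJ h * C.val = B.val := by
  -- B and J have the same constant matrix in bases on which conjugation acts by the same
  -- `pairBlock`. The change of basis `E' * A` is therefore real, and it carries J to B.
  obtain ⟨k, hk, A, A', hA, hA', hAb, hAB⟩ := exists_alternating_factor B.val hBT hB _ B.inv_mul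
  obtain ⟨l, hl, E, E', hE, hE', hEb, hEJ⟩ := exists_alternating_factor (matJ h)
    (matJ_transpose h) (mbar_matJ h) _ (unitJ h).inv_mul
  obtain rfl : k = l := by omega
  have hC : (E' * A) * (A' * E) = 1 := by
    rw [Matrix.mul_assoc, ← Matrix.mul_assoc A, hA, Matrix.one_mul, hE']
  have hEb' : mbar E' = E' * pairBlock k 1 := by
    have h1 : mbar E' * (pairBlock k 1 * E) = 1 := by rw [← hEb, ← mbar_mul, hE', mbar_one]
    calc mbar E' = mbar E' * (pairBlock k 1 * (E * E') * pairBlock k 1) := by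
          rw [hE, Matrix.mul_one, pairBlock_mul_self, one_smul, Matrix.mul_one]
      _ = mbar E' * (pairBlock k 1 * E) * (E' * pairBlock k 1) := by simp only [Matrix.mul_assoc]
      _ = _ := by rw [h1, Matrix.one_mul]
  have hCb : mbar (E' * A) = E' * A := by
    rw [mbar_mul, hAb, hEb', Matrix.mul_assoc, ← Matrix.mul_assoc (pairBlock k 1),
      pairBlock_mul_self, one_smul, Matrix.one_mul]
  refine ⟨⟨E' * A, A' * E, hC, mul_eq_one_comm.mp hC⟩, Units.ext hCb, ?_⟩
  change (E' * A)ᵀ * matJ h * (E' * A) = B.val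
  have hT : (E' * A)ᵀ = Aᴴ * E'ᴴ := by
    rw [← conjTranspose_mbar, hCb, conjTranspose_mul]
  have hEE : E'ᴴ * Eᴴ = 1 := by rw [← conjTranspose_mul, hE, conjTranspose_one]
  calc (E' * A)ᵀ * matJ h * (E' * A)
      = Aᴴ * (E'ᴴ * Eᴴ) * altDiag k * (E * E') * A := by
        rw [hT, ← hEJ]; simp only [Matrix.mul_assoc]
    _ = B.val := by rw [hEE, hE, Matrix.mul_one, Matrix.mul_one, hAB]

/-- A complex orthogonal matrix with `X̄ X = -1` in the basis of conjugate eigenvectors. -/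
theorem exists_orthogonal_factor (X : Matrix (Fin n) (Fin n) ℂ) (hX : Xᵀ * X = 1)
    (hXX : mbar X * X = -1) :
    ∃ (k : ℕ) (_ : k + k = n) (A : Matrix (Fin k ⊕ Fin k) (Fin n) ℂ)
      (A' : Matrix (Fin n) (Fin k ⊕ Fin k) ℂ), A * A' = 1 ∧ A' * A = 1 ∧
      Aᵀ * pairBlock k 1 * A = 1 ∧ mbar A * X = pairBlock k 1 * altDiag k * A := by
  have hX' : X * Xᵀ = 1 := mul_eq_one_comm.mp hX
  have hbarX : mbar X = -Xᵀ := by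
    calc mbar X = mbar X * X * Xᵀ := by rw [Matrix.mul_assoc, hX', Matrix.mul_one]
      _ = _ := by rw [hXX, Matrix.neg_mul, Matrix.one_mul]
  have hXX' : X * mbar X = -1 := by rw [hbarX, Matrix.mul_neg, hX']
  -- Orthogonality turns X̄X = -1 into X̄ = -Xᵀ, so iX is Hermitian; conjugation sends its
  -- eigenvalue μ to -μ⁻¹, of the opposite sign.
  have hH : (Complex.I • X).IsHermitian := by
    rw [IsHermitian, conjTranspose_smul, ← mbar_transpose, hbarX]
    simp
  have hinv : ((-Complex.I) • Xᵀ) * (Complex.I • X) = 1 := by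
    simp [smul_smul, hX]
  have hτ : ∀ (μ : ℝ) (x : Fin n → ℂ), (Complex.I • X) *ᵥ x = (μ : ℂ) • x → x ≠ 0 →
      (Complex.I • X) *ᵥ star x = ((-μ⁻¹ : ℝ) : ℂ) • star x := by
    intro μ x hx hx0
    have h0 : (μ : ℂ) ≠ 0 := by exact_mod_cast eigenvalue_ne_zero hinv hx hx0
    have h1 := congrArg (fun y => X *ᵥ star y) hx
    rw [← mbar_mulVec_star, mbar_smul, smul_mulVec, mulVec_smul, mulVec_mulVec, hXX'] at h1
    simp only [Complex.conj_I, neg_mulVec, one_mulVec, star_smul, mulVec_smul, smul_neg, neg_smul,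
      neg_neg] at h1
    have h2 : star x = (-Complex.I * (μ : ℂ)) • (X *ᵥ star x) := by
      have := congrArg (fun y => (-Complex.I) • y) h1
      simp only [smul_smul] at this
      simpa using this
    conv_rhs => rw [h2]
    rw [smul_mulVec, smul_smul]
    congr 1
    push_cast
    field_simp
  obtain ⟨k, hk, V, d, hV, hV', hHV, hbar, hd, -⟩ := exists_paired_diagonalization
    (Complex.I • X) hH 1 1 one_ne_zero (by simp) (by simp) (fun μ => -μ⁻¹)
    (fun μ x hx hx0 => by rw [one_mulVec]; exact hτ μ x hx hx0)
    (fun μ x hx => by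
      rw [one_mulVec]
      by_cases hx0 : x = 0
      · simp [hx0]
      · have h0 := eigenvalue_ne_zero hinv hx hx0
        refine dotProduct_eq_zero_of_eigenvector_ne hH (fun h => ?_) hx (hτ μ x hx hx0)
        have h1 : μ * μ = -1 := by
          nth_rewrite 2 [h]
          rw [mul_neg, mul_inv_cancel₀ h0]
        nlinarith [mul_self_nonneg μ])
    (fun μ => 0 < μ)
    (fun μ x hx hx0 => by
      rcases (eigenvalue_ne_zero hinv hx hx0).lt_or_gt with h | h
      · right; simpa using h
      · left; exact h)
  rw [Matrix.one_mul] at hbar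
  rw [diagonal_ofReal_elim] at hHV
  have hXV := eq_mul_mul_conjTranspose hV hHV
  -- In the basis V of pairs (v, v̄) the form I has matrix `pairBlock k 1`. The scaling diag(r, r⁻¹)
  -- preserves it and reduces the twisted action of X to a constant matrix.
  let r : Fin k → ℝ := fun i => √(d i)
  have hr : r * r = d := funext fun i => Real.mul_self_sqrt (hd i).le
  have hr' : r * r⁻¹ = 1 := funext fun i => mul_inv_cancel₀ (Real.sqrt_pos.mpr (hd i)).ne'
  have hr'' : r⁻¹ * r = 1 := by rw [mul_comm, hr']
  have hX2 : X = V * (altDiag k * realDiag d d⁻¹) * Vᴴ := by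
    rw [← neg_I_smul_realDiag_neg, Matrix.mul_smul, Matrix.smul_mul]
    have : realDiag d (-d⁻¹) = realDiag d ((fun μ => -μ⁻¹) ∘ d) := rfl
    rw [this, ← hXV]
    simp [smul_smul]
  have hA : realDiag r r⁻¹ * Vᴴ * (V * realDiag r⁻¹ r) = 1 := by
    rw [Matrix.mul_assoc, ← Matrix.mul_assoc Vᴴ, hV', Matrix.one_mul, realDiag_mul, hr', hr'',
      realDiag_one]
  refine ⟨k, hk, realDiag r r⁻¹ * Vᴴ, V * realDiag r⁻¹ r, hA,
    (Matrix.mul_eq_one_comm_of_card_eq _ _ _ (by simp [hk])).mp hA, ?_, ?_⟩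
  · have hVT : Vᴴᵀ = V * pairBlock k 1 := by rw [← hbar]; rfl
    rw [transpose_mul, realDiag_transpose, hVT]
    calc V * pairBlock k 1 * realDiag r r⁻¹ * pairBlock k 1 * (realDiag r r⁻¹ * Vᴴ)
        = V * (pairBlock k 1 * realDiag r r⁻¹ * (pairBlock k 1 * realDiag r r⁻¹)) * Vᴴ := by
          simp only [Matrix.mul_assoc]
      _ = 1 := by rw [pairBlock_mul_realDiag_sq _ _ hr', one_smul, Matrix.mul_one, hV]
  · rw [mbar_mul, mbar_realDiag, mbar_conjTranspose, ← conjTranspose_mbar, hbar, conjTranspose_mul,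
      pairBlock_one_conjTranspose, ← Matrix.mul_assoc, ← pairBlock_mul_realDiag]
    conv_lhs => rw [hX2]
    have h3 : realDiag r⁻¹ r * realDiag d d⁻¹ = realDiag r r⁻¹ := by
      rw [realDiag_mul, ← hr]
      congr 1
      · rw [← mul_assoc, hr'', one_mul]
      · rw [mul_inv, ← mul_assoc, hr', one_mul]
    calc pairBlock k 1 * realDiag r⁻¹ r * Vᴴ * (V * (altDiag k * realDiag d d⁻¹) * Vᴴ)
        = pairBlock k 1 * realDiag r⁻¹ r * (Vᴴ * V) * (altDiag k * realDiag d d⁻¹) * Vᴴ := by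
          simp only [Matrix.mul_assoc]
      _ = pairBlock k 1 * (realDiag r⁻¹ r * altDiag k * realDiag d d⁻¹) * Vᴴ := by
        rw [hV', Matrix.mul_one]; simp only [Matrix.mul_assoc]
      _ = _ := by
        rw [← altDiag_mul_realDiag, Matrix.mul_assoc (altDiag k), h3]
        simp only [Matrix.mul_assoc]

/-- A complex orthogonal matrix with `X̄ X = -1` is twisted-conjugate to `-J_{2m}` by a complex
orthogonal matrix. -/
theorem exists_orthogonal_twisted_coboundary (X : GL (Fin n) ℂ) (hX : X ∈ OC n)
    (hXX : mbar X.val * X.val = -1) :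
    ∃ (m : ℕ) (h : m + m = n) (Q : GL (Fin n) ℂ), Q ∈ OC n ∧ unitJ h * conjHom n Q * X = Q := by
  obtain ⟨k, hk, A, A', hA, hA', hAT, hAX⟩ := exists_orthogonal_factor X.val (mem_OC_iff.mp hX) hXX
  -- The matrix -J satisfies the same hypotheses as X, so both have the same normal form. Comparing
  -- the two bases gives Q with Q̄X = -JQ, and J(-J) = 1.
  obtain ⟨l, hl, E, E', hE, hE', hET, hEJ⟩ := exists_orthogonal_factor (-matJ hk)
    (by rw [transpose_neg, matJ_transpose, neg_neg, Matrix.mul_neg, matJ_sq, neg_neg])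
    (by rw [mbar_neg, mbar_matJ, Matrix.neg_mul, Matrix.mul_neg, neg_neg, matJ_sq])
  obtain rfl : k = l := by omega
  have hQ : (E' * A) * (A' * E) = 1 := by
    rw [Matrix.mul_assoc, ← Matrix.mul_assoc A, hA, Matrix.one_mul, hE']
  refine ⟨k, hk, ⟨E' * A, A' * E, hQ, mul_eq_one_comm.mp hQ⟩, ?_, Units.ext ?_⟩
  · rw [mem_OC_iff]
    change (E' * A)ᵀ * (E' * A) = 1
    have h1 : E'ᵀ * E' = pairBlock k 1 := by
      have hEE : E'ᵀ * Eᵀ = 1 := by rw [← transpose_mul, hE, transpose_one]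
      calc E'ᵀ * E' = E'ᵀ * (Eᵀ * pairBlock k 1 * E) * E' := by rw [hET, Matrix.mul_one]
        _ = (E'ᵀ * Eᵀ) * pairBlock k 1 * (E * E') := by simp only [Matrix.mul_assoc]
        _ = _ := by rw [hEE, hE, Matrix.mul_one, Matrix.one_mul]
    rw [transpose_mul, Matrix.mul_assoc, ← Matrix.mul_assoc E'ᵀ, h1, ← Matrix.mul_assoc, hAT]
  · change matJ hk * mbar (E' * A) * X.val = E' * A
    have hbE : mbar E' * mbar E = 1 := by rw [← mbar_mul, hE', mbar_one]
    have h1 : mbar E' * (pairBlock k 1 * altDiag k) = -(matJ hk) * E' := by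
      calc mbar E' * (pairBlock k 1 * altDiag k)
          = mbar E' * (pairBlock k 1 * altDiag k * E) * E' := by
            simp only [Matrix.mul_assoc, hE, Matrix.mul_one]
        _ = mbar E' * mbar E * (-(matJ hk)) * E' := by rw [← hEJ]; simp only [Matrix.mul_assoc]
        _ = _ := by rw [hbE, Matrix.one_mul]
    rw [mbar_mul, Matrix.mul_assoc, Matrix.mul_assoc, hAX, ← Matrix.mul_assoc (mbar E'), h1,
      ← Matrix.mul_assoc, ← Matrix.mul_assoc, Matrix.mul_neg, matJ_sq, neg_neg, Matrix.one_mul]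

/-- Hermitian matrices compatible with a symplectic form are congruent to `± K_{p,q}` by a
symplectic matrix. -/
theorem exists_symplectic_congr_matK {m : ℕ} (hm : m + m = n) (H : Matrix (Fin n) (Fin n) ℂ)
    (hH : H.IsHermitian) (hHJ : H * matJ hm * mbar H = matJ hm) :
    ∃ (p q : ℕ) (h : p + q = m) (Q : GL (Fin n) ℂ) (ε : ℝ), q ≤ p ∧ (ε = 1 ∨ ε = -1) ∧
      Q ∈ SpC hm ∧ Q.valᴴ * matK h hm * Q.val = (ε : ℂ) • H := by
  have hinv : (matJ hm * mbar H * (-matJ hm)) * H = 1 := by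
    rw [mul_eq_one_comm, ← Matrix.mul_assoc, ← Matrix.mul_assoc, hHJ, Matrix.mul_neg, matJ_sq,
      neg_neg]
  -- The antiunitary map v ↦ -Jv̄ has square -1. It exchanges the eigenvalues μ and μ⁻¹ because HJH̄
  -- = J, and sends v to an orthogonal vector because J is alternating. The sign in -J makes the
  -- form J have matrix [[0, 1], [-1, 0]] in the basis of pairs. As μ and μ⁻¹ have the same sign,
  -- nothing has to be chosen inside a pair.
  obtain ⟨k, hk, V, d, hV, hV', hHV, hbar, -, hd⟩ := exists_paired_diagonalization
    H hH (-matJ hm) (-1) (by norm_num)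
    (by rw [conjTranspose_neg, matJ_conjTranspose, neg_neg, Matrix.mul_neg, matJ_sq, neg_neg])
    (by rw [mbar_neg, mbar_matJ, Matrix.neg_mul, Matrix.mul_neg, neg_neg, matJ_sq]; simp)
    (fun μ => μ⁻¹)
    (fun μ x hx hx0 => by
      have h0 : (μ : ℂ) ≠ 0 := by exact_mod_cast eigenvalue_ne_zero hinv hx hx0
      have h1 : H *ᵥ (matJ hm *ᵥ (mbar H *ᵥ star x)) = matJ hm *ᵥ star x := by
        rw [mulVec_mulVec, mulVec_mulVec, hHJ]
      rw [mbar_mulVec_star, hx, star_smul, mulVec_smul, mulVec_smul] at h1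
      have h2 : ((μ⁻¹ : ℝ) : ℂ) * star (μ : ℂ) = 1 := by
        simp [h0]
      rw [neg_mulVec, mulVec_neg, smul_neg]
      conv_rhs => rw [← h1, smul_smul, h2, one_smul])
    (fun μ x hx => by
      have h1 : star x ⬝ᵥ (matJ hm *ᵥ star x) = -(star x ⬝ᵥ (matJ hm *ᵥ star x)) := by
        conv_lhs => rw [dotProduct_mulVec, ← mulVec_transpose, matJ_transpose, neg_mulVec,
          neg_dotProduct, dotProduct_comm]
      rw [neg_mulVec, dotProduct_neg, neg_eq_zero]
      exact self_eq_neg.mp h1)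
    (fun _ => True) (fun _ _ _ _ => Or.inl trivial)
  obtain rfl : k = m := by omega
  rw [diagonal_ofReal_elim] at hHV
  have hHV2 := eq_mul_mul_conjTranspose hV hHV
  have hd0 : ∀ i, d i ≠ 0 := fun i => by
    obtain ⟨x, hx0, hx⟩ := hd i
    exact eigenvalue_ne_zero hinv hx hx0
  obtain ⟨p, q, h, e, ε, hqp, hε, he⟩ := exists_signature d hd0
  let r : Fin k → ℝ := fun i => √|d i|
  have hr0 : ∀ i, r i ≠ 0 := fun i => (Real.sqrt_pos.mpr (abs_pos.mpr (hd0 i))).ne'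
  have hr : ∀ i, r i * r i = |d i| := fun i => Real.mul_self_sqrt (abs_nonneg _)
  have hr' : r * r⁻¹ = 1 := funext fun i => mul_inv_cancel₀ (hr0 i)
  have hr'' : r⁻¹ * r = 1 := by rw [mul_comm, hr']
  let A : Matrix (Fin k ⊕ Fin k) (Fin n) ℂ := realDiag r r⁻¹ * Vᴴ
  let A' : Matrix (Fin n) (Fin k ⊕ Fin k) ℂ := V * realDiag r⁻¹ r
  have hA : A * A' = 1 := by
    simp only [A, A']
    rw [Matrix.mul_assoc, ← Matrix.mul_assoc Vᴴ, hV', Matrix.one_mul, realDiag_mul, hr', hr'',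
      realDiag_one]
  -- The same permutation is applied to both halves: it sorts the signs and leaves the matrix of the
  -- symplectic form unchanged.
  let E : Fin n ≃ Fin k ⊕ Fin k := (blockEquiv hm).symm.trans (e.sumCongr e)
  have hQ : A.submatrix E id * A'.submatrix id E = 1 := by
    rw [← submatrix_mul _ _ _ _ _ Function.bijective_id, hA, submatrix_one_equiv]
  refine ⟨p, q, h, ⟨A.submatrix E id, A'.submatrix id E, hQ, mul_eq_one_comm.mp hQ⟩, ε, hqp, hε,
    ?_, ?_⟩
  · change (A.submatrix E id)ᵀ * matJ hm * A.submatrix E id = matJ hm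
    have hJE : matJ hm = (-pairBlock k (-1)).submatrix E E := by
      ext i l
      obtain ⟨a, rfl⟩ := (blockEquiv hm).surjective i
      obtain ⟨b, rfl⟩ := (blockEquiv hm).surjective l
      simp only [matJ, reindex_apply, submatrix_apply, Equiv.symm_apply_apply, E,
        Equiv.trans_apply, pairBlock, Matrix.neg_apply]
      rcases a with a | a <;> rcases b with b | b <;> simp [Matrix.one_apply]
    have hb : mbar V = matJ hm * (V * pairBlock k (-1)) := by
      rw [← hbar, Matrix.neg_mul, Matrix.mul_neg, ← Matrix.mul_assoc, matJ_sq, Matrix.neg_mul,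
        Matrix.one_mul, neg_neg]
    conv_lhs => rw [hJE]
    rw [transpose_submatrix, submatrix_mul_equiv, submatrix_mul_equiv, submatrix_id_id]
    have hVT : Vᴴᵀ = mbar V := rfl
    rw [transpose_mul, realDiag_transpose, hVT, hb]
    calc matJ hm * (V * pairBlock k (-1)) * realDiag r r⁻¹ * -pairBlock k (-1) *
          (realDiag r r⁻¹ * Vᴴ)
        = -(matJ hm * V * (pairBlock k (-1) * realDiag r r⁻¹ *
            (pairBlock k (-1) * realDiag r r⁻¹)) * Vᴴ) := by
          simp only [Matrix.mul_assoc, Matrix.mul_neg, Matrix.neg_mul]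
      _ = matJ hm * (V * Vᴴ) := by
          rw [pairBlock_mul_realDiag_sq _ _ hr']
          simp [Matrix.mul_assoc]
      _ = matJ hm := by rw [hV, Matrix.mul_one]
  · change (A.submatrix E id)ᴴ * matK h hm * A.submatrix E id = (ε : ℂ) • H
    let s : Fin k → ℝ := fun i => signVec h (e.symm i)
    have hs : ∀ i, ε * d i = s i * |d i| := fun i => by
      have := he (e.symm i)
      rwa [Equiv.apply_symm_apply] at this
    have hs2 : ∀ i, s i * s i = 1 := fun i => signVec_mul_self h _
    have hKE : matK h hm = (realDiag s s).submatrix E E := by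
      ext i l
      obtain ⟨a, rfl⟩ := (blockEquiv hm).surjective i
      obtain ⟨b, rfl⟩ := (blockEquiv hm).surjective l
      simp only [matK, reindex_apply, submatrix_apply, Equiv.symm_apply_apply, E,
        Equiv.trans_apply, realDiag, matI_eq_diagonal]
      rcases a with a | a <;> rcases b with b | b <;> simp [diagonal_apply, s]
    rw [hKE, conjTranspose_submatrix, submatrix_mul_equiv, submatrix_mul_equiv, submatrix_id_id]
    rw [conjTranspose_mul, conjTranspose_conjTranspose, realDiag_conjTranspose]
    -- The eigenvalues in a pair are d and d⁻¹, of common sign s up to `ε`, so diag(r, r⁻¹)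
    -- normalizes both at once.
    have h1 : realDiag r r⁻¹ * realDiag s s * realDiag r r⁻¹ = (ε : ℂ) • realDiag d d⁻¹ := by
      have : (ε : ℂ) • realDiag d d⁻¹ = realDiag (ε • d) (ε • d⁻¹) := by
        rw [realDiag, realDiag, ← diagonal_smul]
        congr 1
        ext i
        rcases i with i | i <;> simp
      rw [realDiag_mul, realDiag_mul, this]
      congr 1
      · ext i
        simp only [Pi.mul_apply, Pi.smul_apply, smul_eq_mul]
        rw [hs, ← hr]; ring
      · ext i
        simp only [Pi.mul_apply, Pi.smul_apply, smul_eq_mul, Pi.inv_apply]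
        have h2 : ε * ε = 1 := by rcases hε with h | h <;> simp [h]
        have h3 := hs i
        rw [← hr] at h3
        have h4 : (ε * (d i)⁻¹) = (ε * d i)⁻¹ := by
          rw [mul_inv]
          congr 1
          rcases hε with h | h <;> simp [h]
        have h5 : (s i)⁻¹ = s i := inv_eq_of_mul_eq_one_left (hs2 i)
        rw [h4, h3, mul_inv, mul_inv, h5]; ring
    calc V * realDiag r r⁻¹ * realDiag s s * (realDiag r r⁻¹ * Vᴴ)
        = V * (realDiag r r⁻¹ * realDiag s s * realDiag r r⁻¹) * Vᴴ := by
          simp only [Matrix.mul_assoc]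
      _ = (ε : ℂ) • H := by
          rw [h1, Matrix.mul_smul, Matrix.smul_mul]
          congr 1
          exact hHV2.symm


end

section

/-! ### Intertwining matrices -/

variable {Γ : Type*} [Group Γ] {n : ℕ}

/-- A nonzero multiple of an invertible matrix. -/
def smulGL (c : ℂ) (hc : c ≠ 0) (X : GL (Fin n) ℂ) : GL (Fin n) ℂ where
  val := c • X.val
  inv := c⁻¹ • (X⁻¹).val
  val_inv := by
    rw [Matrix.smul_mul, Matrix.mul_smul, smul_smul, mul_inv_cancel₀ hc, one_smul]
    exact X.mul_inv
  inv_val := by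
    rw [Matrix.smul_mul, Matrix.mul_smul, smul_smul, inv_mul_cancel₀ hc, one_smul]
    exact X.inv_mul

@[simp] theorem smulGL_val (c : ℂ) (hc : c ≠ 0) (X : GL (Fin n) ℂ) :
    (smulGL c hc X).val = c • X.val := rfl

theorem smulGL_conj (c : ℂ) (hc : c ≠ 0) (X A : GL (Fin n) ℂ) :
    smulGL c hc X * A * (smulGL c hc X)⁻¹ = X * A * X⁻¹ := by
  rw [mul_inv_eq_iff_eq_mul]
  ext1
  have : (X⁻¹).val * X.val = 1 := X.inv_mul
  simp only [Units.val_mul, smulGL_val, Matrix.smul_mul, Matrix.mul_smul]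
  rw [Matrix.mul_assoc _ (X⁻¹).val, this, Matrix.mul_one]

theorem smul_one_injective (hn : 0 < n) {a b : ℂ}
    (h : a • (1 : Matrix (Fin n) (Fin n) ℂ) = b • 1) : a = b := by
  have := congrFun (congrFun h ⟨0, hn⟩) ⟨0, hn⟩
  simpa using this

theorem ne_zero_of_val_eq_smul_one (hn : 0 < n) (X : GL (Fin n) ℂ) {c : ℂ}
    {Y : Matrix (Fin n) (Fin n) ℂ} (h : X.val = c • Y) : c ≠ 0 := by
  rintro rfl
  rw [zero_smul] at h
  have h1 : X.val * (X⁻¹).val = 1 := X.mul_inv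
  rw [h, Matrix.zero_mul] at h1
  have := congrFun (congrFun h1 ⟨0, hn⟩) ⟨0, hn⟩
  simp at this

theorem conj_mem_bilinGroup {K M : Matrix (Fin n) (Fin n) ℂ} {C A : GL (Fin n) ℂ}
    (hC : C.valᵀ * K * C.val = M) (hA : A ∈ bilinGroup M) : C * A * C⁻¹ ∈ bilinGroup K := by
  rw [mem_bilinGroup_iff] at *
  have h1 : C.val * (C⁻¹).val = 1 := C.mul_inv
  have h2 : (C⁻¹).valᵀ * C.valᵀ = 1 := by rw [← transpose_mul, h1, transpose_one]
  simp only [Units.val_mul, transpose_mul]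
  calc (C⁻¹).valᵀ * (A.valᵀ * C.valᵀ) * K * (C.val * A.val * (C⁻¹).val)
      = (C⁻¹).valᵀ * (A.valᵀ * (C.valᵀ * K * C.val) * A.val) * (C⁻¹).val := by
        simp only [Matrix.mul_assoc]
    _ = ((C⁻¹).valᵀ * C.valᵀ) * K * (C.val * (C⁻¹).val) := by
        rw [hC, hA, ← hC]; simp only [Matrix.mul_assoc]
    _ = K := by rw [h1, h2, Matrix.one_mul, Matrix.mul_one]

theorem conj_mem_hermGroup {K M : Matrix (Fin n) (Fin n) ℂ} {C A : GL (Fin n) ℂ}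
    (hC : C.valᴴ * K * C.val = M) (hA : A ∈ hermGroup M) : C * A * C⁻¹ ∈ hermGroup K := by
  rw [mem_hermGroup_iff] at *
  have h1 : C.val * (C⁻¹).val = 1 := C.mul_inv
  have h2 : (C⁻¹).valᴴ * C.valᴴ = 1 := by rw [← conjTranspose_mul, h1, conjTranspose_one]
  simp only [Units.val_mul, conjTranspose_mul]
  calc (C⁻¹).valᴴ * (A.valᴴ * C.valᴴ) * K * (C.val * A.val * (C⁻¹).val)
      = (C⁻¹).valᴴ * (A.valᴴ * (C.valᴴ * K * C.val) * A.val) * (C⁻¹).val := by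
        simp only [Matrix.mul_assoc]
    _ = ((C⁻¹).valᴴ * C.valᴴ) * K * (C.val * (C⁻¹).val) := by
        rw [hC, hA, ← hC]; simp only [Matrix.mul_assoc]
    _ = K := by rw [h1, h2, Matrix.one_mul, Matrix.mul_one]

theorem smul_mem_hermGroup {M : Matrix (Fin n) (Fin n) ℂ} {A : GL (Fin n) ℂ} (c : ℂ)
    (hA : A ∈ hermGroup M) : A ∈ hermGroup (c • M) := by
  rw [mem_hermGroup_iff] at *
  rw [Matrix.mul_smul, Matrix.smul_mul, hA]

/-- The conjugate of SAS⁻¹ is (S̄X)A(S̄X)⁻¹, hence SAS⁻¹ itself. -/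
theorem conj_mem_GLR {X S A : GL (Fin n) ℂ} (hA : conjHom n A = X * A * X⁻¹)
    (hS : conjHom n S * X = S) : S * A * S⁻¹ ∈ GLR n := by
  rw [mem_GLR_iff]
  have h := eq_mul_inv_of_mul_eq hS
  simp only [map_mul, map_inv, hA, h]
  group

theorem conj_mem_GLH {m : ℕ} (h : m + m = n) {X S A : GL (Fin n) ℂ}
    (hA : conjHom n A = X * A * X⁻¹) (hS : unitJ h * conjHom n S * X = S) :
    S * A * S⁻¹ ∈ GLH h := by
  have h1 : conjHom n S = (unitJ h)⁻¹ * (S * X⁻¹) :=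
    eq_inv_mul_of_mul_eq (eq_mul_inv_of_mul_eq hS)
  have h2 : S * A * S⁻¹ * unitJ h = unitJ h * conjHom n (S * A * S⁻¹) := by
    simp only [map_mul, map_inv, hA, h1]
    group
  exact congrArg Units.val h2

/-- Invariant forms of an irreducible representation are unique up to a scalar. -/
theorem exists_smul_of_invariant_form (f : Γ →* GL (Fin n) ℂ)
    (hf : Function.Surjective (groupAlgHom f)) (L : Γ → Matrix (Fin n) (Fin n) ℂ)
    (X : GL (Fin n) ℂ) (Y : Matrix (Fin n) (Fin n) ℂ)
    (hX : ∀ γ, L γ * X.val * (f γ).val = X.val) (hY : ∀ γ, L γ * Y * (f γ).val = Y) :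
    ∃ c : ℂ, Y = c • X.val := by
  have h1 : (X⁻¹).val * X.val = 1 := X.inv_mul
  have h2 : X.val * (X⁻¹).val = 1 := X.mul_inv
  -- Both X and Y intertwine f with the same dual action, so X⁻¹Y commutes with f and Schur's lemma
  -- applies.
  obtain ⟨c, hc⟩ := exists_scalar_of_commute f hf ((X⁻¹).val * Y) fun γ => by
    have hfi : (f γ).val * ((f γ)⁻¹).val = 1 := (f γ).mul_inv
    have hif : ((f γ)⁻¹).val * (f γ).val = 1 := (f γ).inv_mul
    have e1 : L γ * X.val = X.val * ((f γ)⁻¹).val := by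
      conv_rhs => rw [← hX γ]
      rw [Matrix.mul_assoc _ (f γ).val, hfi, Matrix.mul_one]
    have e2 : L γ * Y = Y * ((f γ)⁻¹).val := by
      conv_rhs => rw [← hY γ]
      rw [Matrix.mul_assoc _ (f γ).val, hfi, Matrix.mul_one]
    have e3 : (f γ).val * (X⁻¹).val * L γ = (X⁻¹).val := by
      calc (f γ).val * (X⁻¹).val * L γ = (f γ).val * (X⁻¹).val * (L γ * X.val) * (X⁻¹).val := by
            simp only [Matrix.mul_assoc, h2, Matrix.mul_one]
        _ = (f γ).val * ((X⁻¹).val * X.val) * ((f γ)⁻¹).val * (X⁻¹).val := by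
            rw [e1]; simp only [Matrix.mul_assoc]
        _ = _ := by rw [h1, Matrix.mul_one, hfi, Matrix.one_mul]
    calc (X⁻¹).val * Y * (f γ).val = (f γ).val * (X⁻¹).val * (L γ * Y) * (f γ).val := by
          conv_lhs => rw [← e3]
          simp only [Matrix.mul_assoc]
      _ = (f γ).val * ((X⁻¹).val * Y) * (((f γ)⁻¹).val * (f γ).val) := by
          rw [e2]; simp only [Matrix.mul_assoc]
      _ = _ := by rw [hif, Matrix.mul_one]
  refine ⟨c, ?_⟩
  calc Y = X.val * ((X⁻¹).val * Y) := by rw [← Matrix.mul_assoc, h2, Matrix.one_mul]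
    _ = c • X.val := by rw [hc, Matrix.mul_smul, Matrix.mul_one]

/-- Conjugating the intertwining relation and substituting it into itself shows that X̄X commutes
with f, so Schur's lemma applies. -/
theorem exists_mbar_mul_self (f : Γ →* GL (Fin n) ℂ)
    (hf : Function.Surjective (groupAlgHom f)) (X : GL (Fin n) ℂ)
    (hX : ∀ γ, conjHom n (f γ) = X * f γ * X⁻¹) : ∃ c : ℂ, mbar X.val * X.val = c • 1 := by
  refine exists_scalar_of_commute f hf _ fun γ => ?_
  have h : f γ = conjHom n X * X * f γ * (conjHom n X * X)⁻¹ := by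
    have := congrArg (conjHom n) (hX γ)
    rw [conjHom_conjHom, map_mul, map_mul, hX γ, map_inv] at this
    rw [_root_.mul_inv_rev]
    simpa only [mul_assoc] using this
  have h2 := mul_eq_of_eq_mul_inv h
  exact (congrArg Units.val h2).symm

theorem exists_conj_normalized (hn : 0 < n) (f : Γ →* GL (Fin n) ℂ)
    (hf : Function.Surjective (groupAlgHom f)) (X : GL (Fin n) ℂ)
    (hX : ∀ γ, conjHom n (f γ) = X * f γ * X⁻¹) :
    ∃ Y : GL (Fin n) ℂ, (∀ γ, conjHom n (f γ) = Y * f γ * Y⁻¹) ∧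
      (mbar Y.val * Y.val = 1 ∨ mbar Y.val * Y.val = -1) := by
  obtain ⟨c, hc⟩ := exists_mbar_mul_self f hf X hX
  have hc0 : c ≠ 0 := ne_zero_of_val_eq_smul_one hn (conjHom n X * X) (Y := 1) hc
  have hc' : X.val * mbar X.val = c • 1 := by
    have h1 : (c⁻¹ • mbar X.val) * X.val = 1 := by
      rw [Matrix.smul_mul, hc, smul_smul, inv_mul_cancel₀ hc0, one_smul]
    have h2 := mul_eq_one_comm.mp h1
    rw [Matrix.mul_smul] at h2
    rw [← h2, smul_smul, mul_inv_cancel₀ hc0, one_smul]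
  -- X̄ is a multiple of X⁻¹, so X̄X = XX̄, which is also the complex conjugate of X̄X.
  have hreal : starRingEnd ℂ c = c := by
    have := congrArg mbar hc
    rw [mbar_mul, mbar_mbar, hc', mbar_smul, mbar_one] at this
    exact (smul_one_injective hn this).symm
  obtain ⟨r, rfl⟩ : ∃ r : ℝ, (r : ℂ) = c := ⟨c.re, Complex.conj_eq_iff_re.mp hreal⟩
  have hr0 : r ≠ 0 := by exact_mod_cast hc0
  -- Replacing X by sX multiplies X̄X by |s|²: the absolute value can be normalized, the sign
  -- cannot.
  let s : ℝ := (√|r|)⁻¹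
  have hs0 : s ≠ 0 := inv_ne_zero (Real.sqrt_pos.mpr (abs_pos.mpr hr0)).ne'
  have hs : s * s * |r| = 1 := by
    simp only [s]
    rw [← mul_inv, Real.mul_self_sqrt (abs_nonneg r), inv_mul_cancel₀ (abs_ne_zero.mpr hr0)]
  refine ⟨smulGL s (by exact_mod_cast hs0) X, fun γ => by rw [smulGL_conj, hX], ?_⟩
  have key : mbar ((s : ℂ) • X.val) * ((s : ℂ) • X.val) = ((s * s * r : ℝ) : ℂ) • 1 := by
    rw [mbar_smul, Matrix.smul_mul, Matrix.mul_smul, hc, smul_smul, smul_smul, Complex.conj_ofReal]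
    push_cast; rw [mul_assoc]
  rw [smulGL_val, key]
  rcases abs_cases r with ⟨h, -⟩ | ⟨h, -⟩
  · left; rw [h] at hs; rw [hs]; simp
  · right
    have : s * s * r = -1 := by rw [h] at hs; linarith
    rw [this]; simp

theorem mbar_mem_bilinGroup {B : Matrix (Fin n) (Fin n) ℂ} (hB : mbar B = B) {A : GL (Fin n) ℂ}
    (hA : A ∈ bilinGroup B) : conjHom n A ∈ bilinGroup B := by
  rw [mem_bilinGroup_iff] at *
  have := congrArg mbar hA
  rwa [mbar_mul, mbar_mul, hB] at this

/-- An intertwiner of a representation in the group of a real bilinear form `B` with its complex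
conjugate can be chosen in the group of `B`. -/
theorem exists_conj_normalized_of_bilin (hn : 0 < n) (f : Γ →* GL (Fin n) ℂ)
    (hf : Function.Surjective (groupAlgHom f)) (B : GL (Fin n) ℂ) (hB : mbar B.val = B.val)
    (hfB : ∀ γ, f γ ∈ bilinGroup B.val) (X : GL (Fin n) ℂ)
    (hX : ∀ γ, conjHom n (f γ) = X * f γ * X⁻¹) :
    ∃ Y : GL (Fin n) ℂ, Y ∈ bilinGroup B.val ∧ (∀ γ, conjHom n (f γ) = Y * f γ * Y⁻¹) ∧
      (mbar Y.val * Y.val = 1 ∨ mbar Y.val * Y.val = -1) := by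
  have hXf : ∀ γ, mbar (f γ).val * X.val = X.val * (f γ).val := fun γ =>
    congrArg Units.val (mul_eq_of_eq_mul_inv (hX γ))
  -- XᵀBX is again an f-invariant form because f̄ preserves the real form B, so it equals μB. A
  -- square root of μ⁻¹ scales X into the group of B.
  obtain ⟨μ, hμ⟩ := exists_smul_of_invariant_form f hf (fun γ => (f γ).valᵀ) B
    (X.valᵀ * B.val * X.val) hfB fun γ => by
      calc (f γ).valᵀ * (X.valᵀ * B.val * X.val) * (f γ).val
          = (X.val * (f γ).val)ᵀ * B.val * (X.val * (f γ).val) := by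
            rw [transpose_mul]; simp only [Matrix.mul_assoc]
        _ = X.valᵀ * ((mbar (f γ).val)ᵀ * B.val * mbar (f γ).val) * X.val := by
            rw [← hXf, transpose_mul]; simp only [Matrix.mul_assoc]
        _ = _ := by rw [show (mbar (f γ).val)ᵀ * B.val * mbar (f γ).val = B.val from
              mbar_mem_bilinGroup hB (hfB γ)]
  have hXT : (X⁻¹).valᵀ * X.valᵀ = 1 := by
    rw [← transpose_mul, show X.val * (X⁻¹).val = 1 from X.mul_inv, transpose_one]
  have hμ0 : μ ≠ 0 := by
    rintro rfl
    rw [zero_smul] at hμ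
    apply ne_zero_of_val_eq_smul_one hn B (c := 0) (Y := 0) _ rfl
    calc B.val = ((X⁻¹).valᵀ * X.valᵀ) * B.val * (X.val * (X⁻¹).val) := by
          rw [hXT, show X.val * (X⁻¹).val = 1 from X.mul_inv, Matrix.one_mul, Matrix.mul_one]
      _ = (X⁻¹).valᵀ * (X.valᵀ * B.val * X.val) * (X⁻¹).val := by simp only [Matrix.mul_assoc]
      _ = _ := by rw [hμ]; simp
  obtain ⟨c, hc⟩ := IsAlgClosed.exists_eq_mul_self μ⁻¹
  have hc0 : c ≠ 0 := by
    rintro rfl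
    rw [mul_zero] at hc
    exact inv_ne_zero hμ0 hc
  have hY : ∀ γ, conjHom n (f γ) = smulGL c hc0 X * f γ * (smulGL c hc0 X)⁻¹ := fun γ => by
    rw [smulGL_conj, hX]
  have hYB : smulGL c hc0 X ∈ bilinGroup B.val := by
    rw [mem_bilinGroup_iff, smulGL_val, transpose_smul, Matrix.smul_mul, Matrix.smul_mul,
      Matrix.mul_smul, hμ, smul_smul, smul_smul, ← hc, inv_mul_cancel₀ hμ0, one_smul]
  refine ⟨_, hYB, hY, ?_⟩
  obtain ⟨a, ha⟩ := exists_mbar_mul_self f hf _ hY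
  have h1 := mul_mem (mbar_mem_bilinGroup hB hYB) hYB
  rw [mem_bilinGroup_iff, Units.val_mul, conjHom_val, ha, transpose_smul, transpose_one,
    Matrix.smul_mul, Matrix.one_mul, Matrix.mul_smul, Matrix.mul_one, smul_smul] at h1
  -- No further scaling is needed: the scalar ȲY lies in the group of B, so its square is 1.
  have h2 : a * a = 1 := by
    apply smul_one_injective hn
    have := congrArg (fun M => M * (B⁻¹).val) h1
    simp only [Matrix.smul_mul] at this
    rwa [show B.val * (B⁻¹).val = 1 from B.mul_inv, ← one_smul ℂ (1 : Matrix (Fin n) (Fin n) ℂ),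
      smul_smul, mul_one] at this
  rw [ha]
  rcases mul_self_eq_one_iff.mp h2 with rfl | rfl
  · left; simp
  · right; simp


end

section

variable {Γ : Type*} [Group Γ] {n : ℕ}

/-! ### The general and special linear groups -/

/-- Taking determinants, |det X|² = (-1)ⁿ. -/
theorem even_of_mbar_mul_self_eq_neg_one (X : GL (Fin n) ℂ) (hX : mbar X.val * X.val = -1) :
    ∃ m, m + m = n := by
  have h1 : (mbar X.val).det = starRingEnd ℂ X.val.det :=
    (RingHom.map_det (starRingEnd ℂ) X.val).symm
  have h2 := congrArg det hX
  rw [det_mul, h1, ← Complex.normSq_eq_conj_mul_self, det_neg, det_one, mul_one,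
    Fintype.card_fin] at h2
  rcases Nat.even_or_odd n with h | h
  · obtain ⟨m, hm⟩ := h
    exact ⟨m, hm.symm⟩
  · exfalso
    rw [h.neg_one_pow] at h2
    have h3 : Complex.normSq X.val.det = -1 := by exact_mod_cast h2
    have := Complex.normSq_nonneg X.val.det
    linarith

theorem exists_conj_mem_GLR_or_GLH (hn : 0 < n) (f : Γ →* GL (Fin n) ℂ)
    (hf : Function.Surjective (groupAlgHom f))
    (htr : ∀ γ, (f γ).val.trace = (conjHom n (f γ)).val.trace) :
    ∃ Q : GL (Fin n) ℂ, (∀ γ, Q * f γ * Q⁻¹ ∈ GLR n) ∨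
      ∃ (m : ℕ) (h : m + m = n), ∀ γ, Q * f γ * Q⁻¹ ∈ GLH h := by
  obtain ⟨X₀, hX₀⟩ := exists_conj_of_trace_eq f ((conjHom n).comp f) hf
    (groupAlgHom_involution_surjective .conj f hf) htr
  obtain ⟨X, hX, h | h⟩ := exists_conj_normalized hn f hf X₀ hX₀
  · obtain ⟨S, hS⟩ := exists_twisted_coboundary 1 X (by
      rw [map_one, one_mul, one_mul]; exact Units.ext h)
    exact ⟨S, Or.inl fun γ => conj_mem_GLR (hX γ) (by rwa [one_mul] at hS)⟩
  · obtain ⟨m, hm⟩ := even_of_mbar_mul_self_eq_neg_one X h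
    obtain ⟨S, hS⟩ := exists_twisted_coboundary (unitJ hm) X (Units.ext (by
      simp only [Units.val_mul, conjHom_val, unitJ_val, mbar_matJ, matJ_sq, Units.val_one]
      rw [Matrix.mul_assoc, h]; simp))
    exact ⟨S, Or.inr ⟨m, hm, fun γ => conj_mem_GLH hm (hX γ) hS⟩⟩

theorem exists_conj_mem_U (hn : 0 < n) (f : Γ →* GL (Fin n) ℂ)
    (hf : Function.Surjective (groupAlgHom f))
    (htr : ∀ γ, (f γ).val.trace = (conjTransposeInvHom n (f γ)).val.trace) :
    ∃ (Q : GL (Fin n) ℂ) (p q : ℕ) (h : p + q = n), q ≤ p ∧ ∀ γ, Q * f γ * Q⁻¹ ∈ U h := by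
  obtain ⟨X, hX⟩ := exists_conj_of_trace_eq f ((conjTransposeInvHom n).comp f) hf
    (groupAlgHom_involution_surjective .conjTransposeInv f hf) htr
  -- Here the intertwiner is an invariant sesquilinear form. Its adjoint is one too, hence a
  -- multiple `a` of it, and taking adjoints twice gives |a| = 1.
  have hfX : ∀ γ, (f γ).valᴴ * X.val * (f γ).val = X.val := fun γ => by
    have h1 : (star (f γ))⁻¹ = X * f γ * X⁻¹ := hX γ
    have h2 : star (f γ) * (X * f γ) = X := by
      rw [← mul_eq_of_eq_mul_inv h1, mul_inv_cancel_left]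
    rw [Matrix.mul_assoc]
    exact congrArg Units.val h2
  obtain ⟨a, ha⟩ := exists_smul_of_invariant_form f hf (fun γ => (f γ).valᴴ) X X.valᴴ hfX
    fun γ => by
      have := congrArg conjTranspose (hfX γ)
      simpa only [conjTranspose_mul, conjTranspose_conjTranspose, Matrix.mul_assoc] using this
  have ha1 : ‖a‖ = 1 := by
    have h1 := congrArg conjTranspose ha
    rw [conjTranspose_conjTranspose, conjTranspose_smul, ha, smul_smul] at h1
    have h2 : star a * a = 1 := by
      apply smul_one_injective hn
      have := congrArg (fun M => M * (X⁻¹).val) h1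
      simp only [Matrix.smul_mul] at this
      rw [show X.val * (X⁻¹).val = 1 from X.mul_inv] at this
      rw [← this, one_smul]
    have h3 : Complex.normSq a = 1 := by
      have : ((Complex.normSq a : ℝ) : ℂ) = 1 := by
        rw [Complex.normSq_eq_conj_mul_self]; exact h2
      exact_mod_cast this
    rw [Complex.normSq_eq_norm_sq] at h3
    exact (pow_eq_one_iff_of_nonneg (norm_nonneg a) two_ne_zero).mp h3
  -- With c² = a and |c| = 1 one has c̄a = c, which is what makes cX Hermitian.
  obtain ⟨c, hc⟩ := IsAlgClosed.exists_eq_mul_self a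
  have hc1 : starRingEnd ℂ c * c = 1 := by
    have h1 : ‖c‖ * ‖c‖ = 1 := by rw [← norm_mul, ← hc, ha1]
    rw [← Complex.normSq_eq_conj_mul_self, Complex.normSq_eq_norm_sq, sq, h1, Complex.ofReal_one]
  have hc0 : c ≠ 0 := by
    rintro rfl
    simp at hc1
  have hH : (c • X.val).IsHermitian := by
    rw [IsHermitian, conjTranspose_smul, ha, smul_smul, hc, ← mul_assoc]
    congr 1
    change starRingEnd ℂ c * c * c = c
    rw [hc1, one_mul]
  have hu : IsUnit (c • X.val).det :=
    (Matrix.isUnit_iff_isUnit_det _).mp (smulGL c hc0 X).isUnit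
  obtain ⟨p, q, h, C, ε, hqp, -, hC⟩ := exists_signature_congr (c • X.val) hH hu
  refine ⟨C, p, q, h, hqp, fun γ => ?_⟩
  rw [U, matI_eq_diagonal]
  exact conj_mem_hermGroup hC (smul_mem_hermGroup _ (smul_mem_hermGroup _ (hfX γ)))

theorem exists_conj_mem_of_GL (hn : 0 < n) (t : InvolutionType) (f : Γ →* GL (Fin n) ℂ)
    (hf : Function.Surjective (groupAlgHom f))
    (htr : ∀ γ, (f γ).val.trace = (t.hom n (f γ)).val.trace) :
    ∃ R : Subgroup (GL (Fin n) ℂ), (R = GLR n ∨ (∃ (m : ℕ) (h : m + m = n), R = GLH h) ∨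
      ∃ (p q : ℕ) (h : p + q = n), q ≤ p ∧ R = U h) ∧
      ∃ Q : GL (Fin n) ℂ, ∀ γ, Q * f γ * Q⁻¹ ∈ R := by
  cases t
  · obtain ⟨Q, hQ | ⟨m, h, hQ⟩⟩ := exists_conj_mem_GLR_or_GLH hn f hf htr
    · exact ⟨_, Or.inl rfl, Q, hQ⟩
    · exact ⟨_, Or.inr (Or.inl ⟨m, h, rfl⟩), Q, hQ⟩
  · obtain ⟨Q, p, q, h, hqp, hQ⟩ := exists_conj_mem_U hn f hf htr
    exact ⟨_, Or.inr (Or.inr ⟨p, q, h, hqp, rfl⟩), Q, hQ⟩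

/-- Scaling by an n-th root of (det Q)⁻¹ does not change the conjugation by Q, so SL reduces to GL.
-/
theorem exists_smulGL_mem_SLC (hn : 0 < n) (Q : GL (Fin n) ℂ) :
    ∃ (c : ℂ) (hc : c ≠ 0), smulGL c hc Q ∈ SLC n := by
  have hd : Q.val.det ≠ 0 := ((Matrix.isUnit_iff_isUnit_det _).mp Q.isUnit).ne_zero
  obtain ⟨c, hc⟩ := IsAlgClosed.exists_pow_nat_eq (Q.val.det)⁻¹ hn
  have hc0 : c ≠ 0 := by
    rintro rfl
    rw [zero_pow hn.ne'] at hc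
    exact inv_ne_zero hd hc.symm
  refine ⟨c, hc0, ?_⟩
  rw [mem_SLC_iff, smulGL_val, det_smul, Fintype.card_fin, hc, inv_mul_cancel₀ hd]

theorem conj_mem_subgroup {G : Subgroup (GL (Fin n) ℂ)} {Q A : GL (Fin n) ℂ} (hQ : Q ∈ G)
    (hA : A ∈ G) : Q * A * Q⁻¹ ∈ G := mul_mem (mul_mem hQ hA) (inv_mem hQ)

theorem conj_mem_SLC {A : GL (Fin n) ℂ} (hA : A ∈ SLC n) (Q : GL (Fin n) ℂ) :
    Q * A * Q⁻¹ ∈ SLC n := (MonoidHom.normal_ker _).conj_mem A hA Q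

theorem exists_conj_mem_of_SL (hn : 0 < n) (t : InvolutionType) (f : Γ →* GL (Fin n) ℂ)
    (hf : Function.Surjective (groupAlgHom f)) (hfS : ∀ γ, f γ ∈ SLC n)
    (htr : ∀ γ, (f γ).val.trace = (t.hom n (f γ)).val.trace) :
    ∃ R : Subgroup (GL (Fin n) ℂ), (R = GLR n ⊓ SLC n ∨
      (∃ (m : ℕ) (h : m + m = n), R = GLH h ⊓ SLC n) ∨
      ∃ (p q : ℕ) (h : p + q = n), q ≤ p ∧ R = U h ⊓ SLC n) ∧
      ∃ Q ∈ SLC n, ∀ γ, Q * f γ * Q⁻¹ ∈ R := by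
  obtain ⟨R, hR, Q, hQ⟩ := exists_conj_mem_of_GL hn t f hf htr
  obtain ⟨c, hc, hcQ⟩ := exists_smulGL_mem_SLC hn Q
  refine ⟨R ⊓ SLC n, ?_, smulGL c hc Q, hcQ, fun γ => Subgroup.mem_inf.mpr ⟨?_, ?_⟩⟩
  · rcases hR with rfl | ⟨m, h, rfl⟩ | ⟨p, q, h, hqp, rfl⟩
    · exact Or.inl rfl
    · exact Or.inr (Or.inl ⟨m, h, rfl⟩)
    · exact Or.inr (Or.inr ⟨p, q, h, hqp, rfl⟩)
  · rw [smulGL_conj]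
    exact hQ γ
  · exact conj_mem_SLC (hfS γ) _

/-! ### The symplectic group -/

theorem exists_conj_mem_of_Sp (hn : 0 < n) {m : ℕ} (hm : m + m = n) (f : Γ →* GL (Fin n) ℂ)
    (hf : Function.Surjective (groupAlgHom f)) (hfJ : ∀ γ, f γ ∈ SpC hm)
    (htr : ∀ γ, (f γ).val.trace = (conjHom n (f γ)).val.trace) :
    ∃ R : Subgroup (GL (Fin n) ℂ), (R = SpR hm ∨
      ∃ (p q : ℕ) (h : p + q = m), q ≤ p ∧ R = Sppq h hm) ∧
      ∃ Q ∈ SpC hm, ∀ γ, Q * f γ * Q⁻¹ ∈ R := by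
  obtain ⟨X₀, hX₀⟩ := exists_conj_of_trace_eq f ((conjHom n).comp f) hf
    (groupAlgHom_involution_surjective .conj f hf) htr
  obtain ⟨X, hXJ, hX, h | h⟩ := exists_conj_normalized_of_bilin hn f hf (unitJ hm) (mbar_matJ hm)
    hfJ X₀ hX₀
  · rw [unitJ_val, mem_bilinGroup_iff] at hXJ
    obtain ⟨S, hS⟩ := exists_twisted_coboundary 1 X (by
      rw [map_one, one_mul, one_mul]; exact Units.ext h)
    rw [one_mul] at hS
    have hSS : S.val * (S⁻¹).val = 1 := S.mul_inv
    have hSS' : (S⁻¹).val * S.val = 1 := S.inv_mul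
    have hST : (S⁻¹).valᵀ * S.valᵀ = 1 := by rw [← transpose_mul, hSS, transpose_one]
    have hST' : S.valᵀ * (S⁻¹).valᵀ = 1 := by rw [← transpose_mul, hSS', transpose_one]
    have hbS : mbar (S⁻¹).val = X.val * (S⁻¹).val := by
      have : conjHom n S⁻¹ = X * S⁻¹ := by
        rw [map_inv, eq_mul_inv_of_mul_eq hS, _root_.mul_inv_rev, inv_inv]
      exact congrArg Units.val this
    have hBinv : (S⁻¹).valᵀ * matJ hm * (S⁻¹).val * (S.val * (-matJ hm) * S.valᵀ) = 1 := by
      calc (S⁻¹).valᵀ * matJ hm * (S⁻¹).val * (S.val * (-matJ hm) * S.valᵀ)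
          = (S⁻¹).valᵀ * matJ hm * ((S⁻¹).val * S.val) * (-matJ hm) * S.valᵀ := by
            simp only [Matrix.mul_assoc]
        _ = 1 := by
            rw [hSS', Matrix.mul_one, Matrix.mul_assoc _ _ (-matJ hm), Matrix.mul_neg, matJ_sq,
              neg_neg, Matrix.mul_one, hST]
    -- S need not be symplectic. It transports J to B, which is real because X is symplectic. A real
    -- C carrying J to B makes CS symplectic without affecting the relation with X̄X = 1.
    let B : GL (Fin n) ℂ := ⟨_, _, hBinv, mul_eq_one_comm.mp hBinv⟩
    have hBval : B.val = (S⁻¹).valᵀ * matJ hm * (S⁻¹).val := rfl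
    have hBT : B.valᵀ = -B.val := by
      rw [hBval, transpose_mul, transpose_mul, transpose_transpose, matJ_transpose]
      simp only [Matrix.neg_mul, Matrix.mul_neg, Matrix.mul_assoc]
    have hBb : mbar B.val = B.val := by
      calc mbar B.val = (mbar (S⁻¹).val)ᵀ * matJ hm * mbar (S⁻¹).val := by
            rw [hBval, mbar_mul, mbar_mul, mbar_matJ]; rfl
        _ = (S⁻¹).valᵀ * (X.valᵀ * matJ hm * X.val) * (S⁻¹).val := by
            rw [hbS, transpose_mul]; simp only [Matrix.mul_assoc]
        _ = B.val := by rw [hXJ]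
    obtain ⟨C, hC, hCB⟩ := exists_real_congr_matJ hm B hBT hBb
    have hQ : C * S ∈ SpC hm := by
      rw [SpC, mem_bilinGroup_iff, Units.val_mul, transpose_mul]
      calc S.valᵀ * C.valᵀ * matJ hm * (C.val * S.val)
          = S.valᵀ * (C.valᵀ * matJ hm * C.val) * S.val := by simp only [Matrix.mul_assoc]
        _ = (S.valᵀ * (S⁻¹).valᵀ) * matJ hm * ((S⁻¹).val * S.val) := by
            rw [hCB, hBval]; simp only [Matrix.mul_assoc]
        _ = matJ hm := by rw [hST', hSS', Matrix.one_mul, Matrix.mul_one]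
    refine ⟨_, Or.inl rfl, C * S, hQ, fun γ => ⟨?_, ?_⟩⟩
    · exact conj_mem_subgroup hQ (hfJ γ)
    · exact conj_mem_GLR (hX γ) (by rw [map_mul, hC, mul_assoc, hS])
  · rw [unitJ_val, mem_bilinGroup_iff] at hXJ
    have hXX : X.val * mbar X.val = -1 := by
      have h1 : (-mbar X.val) * X.val = 1 := by rw [Matrix.neg_mul, h, neg_neg]
      have h2 := mul_eq_one_comm.mp h1
      rw [← h2, Matrix.mul_neg, neg_neg]
    have hXJ' : X.valᴴ * matJ hm * mbar X.val = matJ hm := by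
      have := congrArg mbar hXJ
      rwa [mbar_mul, mbar_mul, mbar_matJ, transpose_mbar] at this
    -- When X̄X = -1, JX is an invariant Hermitian form compatible with J; its symplectic normal
    -- form is ±K.
    have hH : (matJ hm * X.val).IsHermitian := by
      rw [IsHermitian, conjTranspose_mul, matJ_conjTranspose, Matrix.mul_neg]
      conv_rhs => rw [← hXJ']
      rw [Matrix.mul_assoc _ (mbar X.val), h, Matrix.mul_neg, Matrix.mul_one]
    have hHJ : (matJ hm * X.val) * matJ hm * mbar (matJ hm * X.val) = matJ hm := by
      rw [mbar_mul, mbar_matJ]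
      calc matJ hm * X.val * matJ hm * (matJ hm * mbar X.val)
          = matJ hm * X.val * (matJ hm * matJ hm) * mbar X.val := by simp only [Matrix.mul_assoc]
        _ = -(matJ hm * (X.val * mbar X.val)) := by
            rw [matJ_sq]; simp only [Matrix.mul_neg, Matrix.mul_one, Matrix.neg_mul,
              Matrix.mul_assoc]
        _ = _ := by rw [hXX]; simp
    obtain ⟨p, q, hpq, Q, ε, hqp, -, hQ, hQK⟩ :=
      exists_symplectic_congr_matK hm (matJ hm * X.val) hH hHJ
    refine ⟨_, Or.inr ⟨p, q, hpq, hqp, rfl⟩, Q, hQ, fun γ => ⟨?_, ?_⟩⟩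
    · exact conj_mem_subgroup hQ (hfJ γ)
    · refine conj_mem_hermGroup hQK (smul_mem_hermGroup _ ?_)
      rw [mem_hermGroup_iff]
      have hXf : mbar (f γ).val * X.val = X.val * (f γ).val :=
        congrArg Units.val (mul_eq_of_eq_mul_inv (hX γ))
      have hfb : (f γ).valᴴ * matJ hm * mbar (f γ).val = matJ hm :=
        mbar_mem_bilinGroup (mbar_matJ hm) (hfJ γ)
      calc (f γ).valᴴ * (matJ hm * X.val) * (f γ).val
          = (f γ).valᴴ * matJ hm * mbar (f γ).val * X.val := by
            simp only [Matrix.mul_assoc]; rw [hXf]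
        _ = _ := by rw [hfb]

/-! ### The orthogonal and special orthogonal groups -/

theorem exists_conj_mem_of_O (hn : 0 < n) (f : Γ →* GL (Fin n) ℂ)
    (hf : Function.Surjective (groupAlgHom f)) (hfO : ∀ γ, f γ ∈ OC n)
    (htr : ∀ γ, (f γ).val.trace = (conjHom n (f γ)).val.trace) :
    ∃ Q ∈ OC n, (∃ (m : ℕ) (h : m + m = n), ∀ γ, Q * f γ * Q⁻¹ ∈ OH h) ∨
      ∃ (p q : ℕ) (h : p + q = n), q ≤ p ∧ ∀ γ, Q * f γ * Q⁻¹ ∈ Opq' h := by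
  obtain ⟨X₀, hX₀⟩ := exists_conj_of_trace_eq f ((conjHom n).comp f) hf
    (groupAlgHom_involution_surjective .conj f hf) htr
  obtain ⟨X, hXO, hX, h | h⟩ := exists_conj_normalized_of_bilin hn f hf 1 mbar_one hfO X₀ hX₀
  · have hXT : X.valᵀ * X.val = 1 := mem_OC_iff.mp hXO
    obtain ⟨S, hS⟩ := exists_twisted_coboundary 1 X (by
      rw [map_one, one_mul, one_mul]; exact Units.ext h)
    rw [one_mul] at hS
    have hSS' : (S⁻¹).val * S.val = 1 := S.inv_mul
    have hST' : S.valᵀ * (S⁻¹).valᵀ = 1 := by rw [← transpose_mul, hSS', transpose_one]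
    have hbS : mbar (S⁻¹).val = X.val * (S⁻¹).val := by
      have : conjHom n S⁻¹ = X * S⁻¹ := by
        rw [map_inv, eq_mul_inv_of_mul_eq hS, _root_.mul_inv_rev, inv_inv]
      exact congrArg Units.val this
    -- The form I transported by S; it is real because X is orthogonal, and Sylvester's law over ℝ
    -- diagonalizes it by a real matrix.
    let B : Matrix (Fin n) (Fin n) ℂ := (S⁻¹).valᵀ * (S⁻¹).val
    have hBb : mbar B = B := by
      calc mbar B = (mbar (S⁻¹).val)ᵀ * mbar (S⁻¹).val := by
            rw [mbar_mul]; rfl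
        _ = (S⁻¹).valᵀ * (X.valᵀ * X.val) * (S⁻¹).val := by
            rw [hbS, transpose_mul]; simp only [Matrix.mul_assoc]
        _ = B := by rw [hXT, Matrix.mul_one]
    obtain ⟨R, hR⟩ := exists_map_ofReal_eq hBb
    have inj : Function.Injective fun M : Matrix (Fin n) (Fin n) ℝ => M.map (algebraMap ℝ ℂ) :=
      Matrix.map_injective (algebraMap ℝ ℂ).injective
    have hRH : R.IsHermitian := by
      rw [IsHermitian, conjTranspose_eq_transpose_of_trivial]
      apply inj
      change Rᵀ.map (algebraMap ℝ ℂ) = R.map (algebraMap ℝ ℂ)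
      rw [transpose_map, hR]
      simp only [B, transpose_mul, transpose_transpose]
    have hRu : IsUnit R.det := by
      have h1 : algebraMap ℝ ℂ R.det = B.det := by
        rw [RingHom.map_det]
        exact congrArg det hR
      have h2 : B.det ≠ 0 := by
        simp only [B, det_mul, det_transpose]
        exact mul_self_ne_zero.mpr ((Matrix.isUnit_iff_isUnit_det _).mp (S⁻¹).isUnit).ne_zero
      rw [isUnit_iff_ne_zero]
      intro h0
      rw [h0, map_zero] at h1
      exact h2 h1.symm
    obtain ⟨p, q, hpq, C₀, ε, hqp, hε, hC₀⟩ := exists_signature_congr R hRH hRu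
    let C : GL (Fin n) ℂ := GeneralLinearGroup.map (algebraMap ℝ ℂ) C₀
    have hCR : conjHom n C = C := mem_GLR_iff.mp ⟨C₀, rfl⟩
    have hC : C.valᵀ * matI hpq * C.val = (ε : ℂ) • B := by
      have h1 := congrArg (fun M : Matrix (Fin n) (Fin n) ℝ => M.map (algebraMap ℝ ℂ)) hC₀
      simp only [Matrix.map_mul, conjTranspose_eq_transpose_of_trivial] at h1
      have h2 : (((ε : ℝ) : ℝ) • R).map (algebraMap ℝ ℂ) = (ε : ℂ) • B := by
        rw [← hR]; ext; simp
      have h3 : (diagonal fun i => (signVec hpq i : ℝ)).map (algebraMap ℝ ℂ) = matI hpq := by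
        rw [matI_eq_diagonal, diagonal_map (map_zero _)]
        rfl
      rw [← h2, ← h3]
      exact h1
    -- A square root of the sign `ε` absorbs it into the conjugator. The scalar may be imaginary,
    -- but the conjugation is still that by `C * S`. Multiplying by D, where DᵀD is the matrix I
    -- with signs, makes the conjugator orthogonal.
    obtain ⟨c, hc⟩ := IsAlgClosed.exists_eq_mul_self (ε : ℂ)
    have hεε : (ε : ℂ) * ε = 1 := by rcases hε with h | h <;> simp [h]
    have hc0 : c ≠ 0 := by
      rintro rfl
      rw [hc] at hεε
      simp at hεε
    let S₁ := smulGL c hc0 (C * S)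
    have hS₁ : S₁.valᵀ * matI hpq * S₁.val = 1 := by
      simp only [S₁, smulGL_val, Units.val_mul, transpose_smul, transpose_mul]
      calc (c • (S.valᵀ * C.valᵀ)) * matI hpq * (c • (C.val * S.val))
          = (c * c) • (S.valᵀ * (C.valᵀ * matI hpq * C.val) * S.val) := by
            simp only [Matrix.smul_mul, Matrix.mul_smul, smul_smul, Matrix.mul_assoc]
        _ = S.valᵀ * B * S.val := by
            rw [hC, ← hc, Matrix.mul_smul, Matrix.smul_mul, smul_smul, hεε, one_smul]
        _ = (S.valᵀ * (S⁻¹).valᵀ) * ((S⁻¹).val * S.val) := by simp only [B, Matrix.mul_assoc]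
        _ = 1 := by rw [hST', hSS', Matrix.one_mul]
    refine ⟨matD hpq * S₁, ?_, Or.inr ⟨p, q, hpq, hqp, fun γ => ⟨S₁ * f γ * S₁⁻¹, ⟨?_, ?_⟩, ?_⟩⟩⟩
    · rw [mem_OC_iff, Units.val_mul, transpose_mul]
      calc S₁.valᵀ * (matD hpq).valᵀ * ((matD hpq).val * S₁.val)
          = S₁.valᵀ * ((matD hpq).valᵀ * (matD hpq).val) * S₁.val := by
            simp only [Matrix.mul_assoc]
        _ = 1 := by rw [matD_transpose_mul, hS₁]
    · have : S₁ * f γ * S₁⁻¹ = (C * S) * f γ * (C * S)⁻¹ := smulGL_conj _ _ _ _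
      rw [this]
      exact conj_mem_GLR (hX γ) (by rw [map_mul, hCR, mul_assoc, hS])
    · exact conj_mem_bilinGroup hS₁ (hfO γ)
    · change matD hpq * (S₁ * f γ * S₁⁻¹) * (matD hpq)⁻¹ = _
      group
  · obtain ⟨m, hm, Q, hQ, hQX⟩ := exists_orthogonal_twisted_coboundary X hXO h
    refine ⟨Q, hQ, Or.inl ⟨m, hm, fun γ => ⟨?_, conj_mem_GLH hm (hX γ) hQX⟩⟩⟩
    exact conj_mem_subgroup hQ (hfO γ)

theorem det_eq_one_or_neg_one {Q : GL (Fin n) ℂ} (hQ : Q ∈ OC n) :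
    Q.val.det = 1 ∨ Q.val.det = -1 := by
  have := congrArg det (mem_OC_iff.mp hQ)
  rw [det_mul, det_transpose, det_one] at this
  exact mul_self_eq_one_iff.mp this

/-- A reflection in `O(p, q)` that commutes with `D_{p,q}`. -/
theorem exists_reflection_mem_Opq' (hn : 0 < n) {p q : ℕ} (h : p + q = n) :
    ∃ E ∈ OC n, E.val.det = -1 ∧ E ∈ Opq' h := by
  let d : Fin n → ℂ := Function.update 1 ⟨0, hn⟩ (-1)
  have hd : ∀ i, d i * d i = 1 := by
    intro i
    by_cases hi : i = ⟨0, hn⟩ <;> simp [d, hi]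
  have hdr : ∀ i, starRingEnd ℂ (d i) = d i := by
    intro i
    by_cases hi : i = ⟨0, hn⟩ <;> simp [d, hi]
  have hE : diagonal d * diagonal d = 1 := by
    rw [diagonal_mul_diagonal]; simp [hd]
  let E : GL (Fin n) ℂ := ⟨diagonal d, diagonal d, hE, hE⟩
  refine ⟨E, ?_, ?_, E, ⟨?_, ?_⟩, ?_⟩
  · rw [mem_OC_iff]
    change (diagonal d)ᵀ * diagonal d = 1
    rw [diagonal_transpose, hE]
  · change (diagonal d).det = -1
    rw [det_diagonal, Finset.prod_update_of_mem (Finset.mem_univ _)]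
    simp
  · refine mem_GLR_iff.mpr ?_
    ext1
    change (diagonal d).map (starRingEnd ℂ) = diagonal d
    rw [diagonal_map (map_zero _)]
    simp [hdr]
  · change (diagonal d)ᵀ * matI h * diagonal d = matI h
    rw [matI_eq_diagonal, diagonal_transpose, diagonal_mul_diagonal, diagonal_mul_diagonal]
    congr 1
    ext i
    rw [mul_right_comm, hd, one_mul]
  · change matD h * E * (matD h)⁻¹ = E
    rw [mul_inv_eq_iff_eq_mul]
    ext1
    change (matD h).val * diagonal d = diagonal d * (matD h).val
    rw [matD_eq_diagonal, diagonal_mul_diagonal, diagonal_mul_diagonal]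
    simp only [mul_comm]

theorem mem_SOpq' {p q : ℕ} (h : p + q = n) {A : GL (Fin n) ℂ} (hA : A ∈ Opq' h)
    (hdet : A ∈ SLC n) : A ∈ SOpq' h := by
  obtain ⟨M, hM, rfl⟩ := hA
  refine ⟨M, ⟨hM, ?_⟩, rfl⟩
  have := conj_mem_SLC hdet (matD h)⁻¹
  have e : (matD h)⁻¹ * (MulAut.conj (matD h)).toMonoidHom M * (matD h)⁻¹⁻¹ = M := by
    change (matD h)⁻¹ * (matD h * M * (matD h)⁻¹) * (matD h)⁻¹⁻¹ = M
    group
  rwa [e] at this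

/-- For odd `m`, the matrix `I_{m,m}` normalizes `O(m, ℍ)` and has determinant `-1`. -/
theorem exists_normalizer_OH {m : ℕ} (h : m + m = n) (hm : Odd m) :
    ∃ E ∈ OC n, E.val.det = -1 ∧ ∀ A ∈ OH h, E * A * E⁻¹ ∈ OH h := by
  have hI : matI h * matI h = 1 := by
    rw [matI_eq_diagonal, diagonal_mul_diagonal, ← diagonal_one]
    congr 1
    ext i
    exact_mod_cast signVec_mul_self h i
  have hIT : (matI h)ᵀ = matI h := by rw [matI_eq_diagonal, diagonal_transpose]
  have hIb : mbar (matI h) = matI h := by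
    rw [matI_eq_diagonal, mbar, diagonal_map (map_zero _)]
    simp
  have hIJ : matI h * matJ h = -(matJ h * matI h) := by
    rw [matI, matJ, reindex_apply, reindex_apply, submatrix_mul_equiv, submatrix_mul_equiv,
      fromBlocks_multiply, fromBlocks_multiply]
    ext i l
    rw [Matrix.neg_apply, submatrix_apply, submatrix_apply]
    rcases (blockEquiv h).symm i with a | a <;> rcases (blockEquiv h).symm l with b | b <;> simp
  let E : GL (Fin n) ℂ := ⟨matI h, matI h, hI, hI⟩
  have hE : E ∈ OC n := by
    rw [mem_OC_iff]
    change (matI h)ᵀ * matI h = 1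
    rw [hIT, hI]
  refine ⟨E, hE, ?_, fun A hA => ⟨conj_mem_subgroup hE hA.1, ?_⟩⟩
  · change (matI h).det = -1
    rw [matI, det_reindex_self, det_fromBlocks_zero₂₁, det_one, one_mul, det_neg, det_one, mul_one,
      Fintype.card_fin, hm.neg_one_pow]
  · have hA' := (mem_GLH_iff h).mp hA.2
    change matI h * A.val * matI h * matJ h = matJ h * mbar (matI h * A.val * matI h)
    rw [mbar_mul, mbar_mul, hIb]
    calc matI h * A.val * matI h * matJ h = matI h * A.val * (matI h * matJ h) := by
          simp only [Matrix.mul_assoc]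
      _ = -(matI h * (A.val * matJ h) * matI h) := by
          rw [hIJ]; simp only [Matrix.mul_neg, Matrix.mul_assoc]
      _ = -(matI h * matJ h) * (mbar A.val * matI h) := by
          rw [hA']; simp only [Matrix.neg_mul, Matrix.mul_assoc]
      _ = _ := by rw [hIJ, neg_neg]; simp only [Matrix.mul_assoc]

/-- The conjugator found for O has determinant ±1. If it is -1, multiply it by a matrix of
determinant -1: a reflection in the group for O(p,q), I with m minus signs for O(m,ℍ) with m odd,
and P₀ for m even. -/
theorem exists_conj_mem_of_SO (hn : 0 < n) (P₀ : GL (Fin n) ℂ) (hP₀ : P₀ ∈ OC n)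
    (hP₀' : P₀ ∉ SOC n) (f : Γ →* GL (Fin n) ℂ)
    (hf : Function.Surjective (groupAlgHom f)) (hfO : ∀ γ, f γ ∈ SOC n)
    (htr : ∀ γ, (f γ).val.trace = (conjHom n (f γ)).val.trace) :
    ∃ R : Subgroup (GL (Fin n) ℂ), ((∃ (m : ℕ) (h : m + m = n), R = SOH h) ∨
      (∃ (m : ℕ) (h : m + m = n), Even m ∧ R = conjSubgroup P₀ (SOH h)) ∨
      ∃ (p q : ℕ) (h : p + q = n), q ≤ p ∧ R = SOpq' h) ∧
      ∃ Q ∈ SOC n, ∀ γ, Q * f γ * Q⁻¹ ∈ R := by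
  have hP₀d : P₀.val.det = -1 :=
    (det_eq_one_or_neg_one hP₀).resolve_left fun h => hP₀' ⟨mem_SLC_iff.mpr h, hP₀⟩
  have hmul : ∀ {E Q : GL (Fin n) ℂ}, E ∈ OC n → E.val.det = -1 → Q ∈ OC n → Q.val.det = -1 →
      E * Q ∈ SOC n := by
    intro E Q hE hEd hQ hQd
    refine ⟨mem_SLC_iff.mpr ?_, mul_mem hE hQ⟩
    rw [Units.val_mul, det_mul, hEd, hQd]
    norm_num
  have hassoc : ∀ E Q A : GL (Fin n) ℂ, E * Q * A * (E * Q)⁻¹ = E * (Q * A * Q⁻¹) * E⁻¹ := by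
    intro E Q A; group
  obtain ⟨Q, hQ, ⟨m, h, hQf⟩ | ⟨p, q, h, hqp, hQf⟩⟩ :=
    exists_conj_mem_of_O hn f hf (fun γ => (hfO γ).2) htr
  · rcases det_eq_one_or_neg_one hQ with hd | hd
    · exact ⟨_, Or.inl ⟨m, h, rfl⟩, Q, ⟨mem_SLC_iff.mpr hd, hQ⟩,
        fun γ => ⟨hQf γ, conj_mem_SLC (hfO γ).1 Q⟩⟩
    · rcases Nat.even_or_odd m with hm | hm
      · refine ⟨_, Or.inr (Or.inl ⟨m, h, hm, rfl⟩), P₀ * Q, hmul hP₀ hP₀d hQ hd, fun γ => ?_⟩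
        rw [hassoc]
        exact ⟨Q * f γ * Q⁻¹, ⟨hQf γ, conj_mem_SLC (hfO γ).1 Q⟩, rfl⟩
      · obtain ⟨E, hE, hEd, hEn⟩ := exists_normalizer_OH h hm
        refine ⟨_, Or.inl ⟨m, h, rfl⟩, E * Q, hmul hE hEd hQ hd, fun γ => ⟨?_, ?_⟩⟩
        · rw [hassoc]
          exact hEn _ (hQf γ)
        · exact conj_mem_SLC (hfO γ).1 _
  · refine ⟨_, Or.inr (Or.inr ⟨p, q, h, hqp, rfl⟩), ?_⟩
    rcases det_eq_one_or_neg_one hQ with hd | hd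
    · exact ⟨Q, ⟨mem_SLC_iff.mpr hd, hQ⟩,
        fun γ => mem_SOpq' h (hQf γ) (conj_mem_SLC (hfO γ).1 Q)⟩
    · obtain ⟨E, hE, hEd, hEm⟩ := exists_reflection_mem_Opq' hn h
      refine ⟨E * Q, hmul hE hEd hQ hd, fun γ => mem_SOpq' h ?_ (conj_mem_SLC (hfO γ).1 _)⟩
      rw [hassoc]
      exact conj_mem_subgroup hEm (hQf γ)

/-! ### Conclusion -/

theorem exists_hom_of_conj_mem {G R : Subgroup (GL (Fin n) ℂ)} (ρ : Γ →* G) (Q : GL (Fin n) ℂ)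
    (hQ : Q ∈ G) (h : ∀ γ, Q * (ρ γ).1 * Q⁻¹ ∈ R) :
    ∃ (σ : Γ →* R) (P : G), ∀ γ : Γ,
      (P : GL (Fin n) ℂ) * ρ γ * (P : GL (Fin n) ℂ)⁻¹ = σ γ :=
  ⟨(((MulAut.conj Q).toMonoidHom.comp (G.subtype.comp ρ))).codRestrict R h, ⟨Q, hQ⟩,
    fun _ => rfl⟩


end

end

end CharVar

/-! ### The main theorem -/

open CharVar
theorem theorem1p1 (n : ℕ) (hn : 0 < n) (Γ : Type*) [Group Γ] [Group.FG Γ]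
    (T : ClassicalType) (t : InvolutionType)
    (P₀ : GL (Fin (T.dim n)) ℂ) (hP₀ : P₀ ∈ OC (T.dim n)) (hP₀' : P₀ ∉ SOC (T.dim n))
    (ρ : Γ →* T.group n) (hρ : IsIrreducibleRep ρ) (hΦ : Phi t T n (chi ρ) = chi ρ) :
    ∃ R : Subgroup (GL (Fin (T.dim n)) ℂ), IsRealForm T n P₀ R ∧
      ∃ (σ : Γ →* R) (P : T.group n),
        ∀ γ : Γ, (P : GL (Fin (T.dim n)) ℂ) * ρ γ * (P : GL (Fin (T.dim n)) ℂ)⁻¹ = σ γ := by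
  have hn' : 0 < T.dim n := by
    cases T <;> simp [ClassicalType.dim, hn]
  have hf := groupAlgHom_surjective hn' ((T.group n).subtype.comp ρ) hρ
  have htr := trace_eq_of_Phi_chi_eq t T n ρ hΦ
  cases T
  · obtain ⟨R, hR, Q, hQ⟩ := exists_conj_mem_of_GL hn t _ hf htr
    exact ⟨R, hR, exists_hom_of_conj_mem ρ Q trivial hQ⟩
  · obtain ⟨R, hR, Q, hQ, hQf⟩ := exists_conj_mem_of_SL hn t _ hf (fun γ => (ρ γ).2) htr
    exact ⟨R, hR, exists_hom_of_conj_mem ρ Q hQ hQf⟩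
  -- From here on the group preserves a bilinear form, so either involution gives the trace
  -- condition for complex conjugation.
  · obtain ⟨Q, hQ, ⟨m, h, hQf⟩ | ⟨p, q, h, hqp, hQf⟩⟩ := exists_conj_mem_of_O hn _ hf
      (fun γ => (ρ γ).2) fun γ => (htr γ).trans
        (trace_hom_of_mem_bilinGroup t (B := 1) mbar_one (ρ γ).2)
    · exact ⟨_, Or.inl ⟨m, h, rfl⟩, exists_hom_of_conj_mem ρ Q hQ hQf⟩
    · exact ⟨_, Or.inr ⟨p, q, h, hqp, rfl⟩, exists_hom_of_conj_mem ρ Q hQ hQf⟩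
  · obtain ⟨R, hR, Q, hQ, hQf⟩ := exists_conj_mem_of_SO hn P₀ hP₀ hP₀' _ hf
      (fun γ => (ρ γ).2) fun γ => (htr γ).trans
        (trace_hom_of_mem_bilinGroup t (B := 1) mbar_one (ρ γ).2.2)
    exact ⟨R, hR, exists_hom_of_conj_mem ρ Q hQ hQf⟩
  · obtain ⟨R, hR, Q, hQ, hQf⟩ := exists_conj_mem_of_Sp hn' (two_mul n).symm _ hf
      (fun γ => (ρ γ).2) fun γ => (htr γ).trans
        (trace_hom_of_mem_bilinGroup t (B := unitJ _) (mbar_matJ _) (ρ γ).2)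
    exact ⟨R, hR, exists_hom_of_conj_mem ρ Q hQ hQf⟩
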